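/- All Hilbert spaces are finite-dimensional and complex, and $\mathrm{L}(A)$ denotes the linear operators on $A$. For $f:(0,\infty)\to[0,\infty)$ put $f(0^+)=\lim_{x\downarrow 0}f(x)$, $f'(+\infty)=\lim_{x\to\infty}f(x)/x$, and let $P_f(x,y)=y f(x/y)$ for $x,y>0$, $P_f(0,y)=y f(0^+)$, $P_f(x,0)=x f'(+\infty)$. For a quantum state $\sigma=\sum_i\lambda_i Q_i$ on $A$ (spectral decomposition with rank-one projections $Q_i$) and $X,Y\in\mathrm{L}(A)$ put $$\mathbf{J}_{f,\sigma}(X)=\sum_{i,j}P_f(\lambda_i,\lambda_j)\,Q_iXQ_j,\qquad \langle X,Y\rangle_{f,\sigma}=\mathrm{Tr}[X^*\mathbf{J}_{f,\sigma}(Y)].$$ For a state $\rho_{AB}$ on $A\otimes B$ with marginals $\rho_A,\rho_B$ let $$\mu^{\mathrm{Lin}}_f(A:B)_\rho=\sup\big\{\,|\mathrm{Tr}[(X\otimes Y^*)\rho_{AB}]| \;:\; X\in\mathrm{L}(A),\ Y\in\mathrm{L}(B),\ \langle \mathbb{1},X\rangle_{f,\rho_A}=\langle \mathbb{1},Y\rangle_{f,\rho_B}=0,\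 \langle X,X\rangle_{f,\rho_A}=\langle Y,Y\rangle_{f,\rho_B}=1\,\big\},$$ a supremum in $[0,\infty]$ (so it is $0$ if no such pair exists). For $k\in[0,1]$ let $f_k(x)=x^k$. A linear map $\mathcal{E}:\mathrm{L}(A)\to\mathrm{L}(B)$ is $2$-positive if $\mathrm{id}_{\mathrm{L}(\mathbb{C}^2)}\otimes\mathcal{E}$ maps positive semidefinite operators to positive semidefinite operators. **Theorem.** Let $\rho_{AB}$ and $\sigma_{A'B'}$ be quantum states. 1. If there are $n\in\mathbb{N}$ and $2$-positive trace-preserving linear maps $\mathcal{E}:\mathrm{L}(A^{\otimes n})\to\mathrm{L}(A')$, $\mathcal{F}:\mathrm{L}(B^{\otimes n})\to\mathrm{L}(B')$ with $(\mathcal{E}\otimes\mathcal{F})(\rho_{AB}^{\otimes n})=\sigma_{A'B'}$, then $$\mu^{\mathrm{Lin}}_{f_k}(A:B)_\rho\ \ge\ \mu^{\mathrm{Lin}}_{f_k}(A':B')_\sigma\qquad\text{for all }k\in[0,1].$$ 2. For all $k\in[0,1]$, $\mu^{\mathrm{Lin}}_{f_k}$ tensorizes: $$\mu^{\mathrm{Lin}}_{f_k}(AA':BB')_{\rho\otimes\sigma}=\max\{\mu^{\mathrm{Lin}}_{f_k}(A:B)_\rho,\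 \mu^{\mathrm{Lin}}_{f_k}(A':B')_\sigma\}.$$ -/

import Mathlib

open Filter Topology
open scoped Matrix Kronecker ENNReal ComplexOrder

noncomputable section

namespace MaxCorr

/-- Quantum states on the Hilbert space `ℂ^ι`: positive semidefinite matrices of trace one. -/
def IsState {ι : Type*} [Fintype ι] (ρ : Matrix ι ι ℂ) : Prop :=
  ρ.PosSemidef ∧ ρ.trace = 1

/-- The marginal `ρ_A = Tr_B ρ_AB`. -/
def marginalA {A B : Type*} [Fintype B] (ρ : Matrix (A × B) (A × B) ℂ) : Matrix A A ℂ :=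
  Matrix.of fun a a' => ∑ b, ρ (a, b) (a', b)

/-- The marginal `ρ_B = Tr_A ρ_AB`. -/
def marginalB {A B : Type*} [Fintype A] (ρ : Matrix (A × B) (A × B) ℂ) : Matrix B B ℂ :=
  Matrix.of fun b b' => ∑ a, ρ (a, b) (a, b')

/-- The perspective function `P_f` on `[0, ∞) × [0, ∞)`: it is `y f(x / y)` for `x, y > 0`,
`y f(0⁺)` for `x = 0`, and `x f'(+∞)` for `y = 0`, where `f(0⁺) = lim_{x ↓ 0} f(x)` and
`f'(+∞) = lim_{x → ∞} f(x) / x`. -/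
def perspective (f : ℝ → ℝ) (x y : ℝ) : ℝ :=
  if x = 0 then y * limUnder (𝓝[>] (0 : ℝ)) f
  else if y = 0 then x * limUnder atTop (fun t : ℝ => f t / t)
  else y * f (x / y)

/-- The rank-one orthogonal projection onto the `i`-th vector of an orthonormal eigenbasis
of the Hermitian matrix `σ`. -/
def eigenProj {ι : Type*} [Fintype ι] [DecidableEq ι] {σ : Matrix ι ι ℂ}
    (hσ : σ.IsHermitian) (i : ι) : Matrix ι ι ℂ :=
  Matrix.vecMulVec (fun a => hσ.eigenvectorBasis i a) (fun a => star (hσ.eigenvectorBasis i a))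

open Classical in
/-- The operator `J_{f,σ} = f(L_σ R_σ⁻¹) R_σ`, that is
`J_{f,σ}(X) = ∑ i j, P_f(λ_i, λ_j) Q_i X Q_j` for the spectral decomposition `σ = ∑ i, λ_i Q_i`.
It is only used for Hermitian `σ`. -/
def Jop {ι : Type*} [Fintype ι] [DecidableEq ι] (f : ℝ → ℝ) (σ X : Matrix ι ι ℂ) :
    Matrix ι ι ℂ :=
  if hσ : σ.IsHermitian then
    ∑ i, ∑ j, ((perspective f (hσ.eigenvalues i) (hσ.eigenvalues j) : ℝ) : ℂ) •
      (eigenProj hσ i * X * eigenProj hσ j)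
  else 0

/-- `⟨X, Y⟩_{f,σ} = Tr[X* J_{f,σ}(Y)]`. -/
def innerJ {ι : Type*} [Fintype ι] [DecidableEq ι] (f : ℝ → ℝ) (σ X Y : Matrix ι ι ℂ) : ℂ :=
  (Xᴴ * Jop f σ Y).trace

/-- The maximal correlation coefficient `μ_f^Lin(A:B)_ρ`: the supremum of `|Tr[(X ⊗ Y*) ρ_AB]|`
over all linear operators `X` on `A` and `Y` on `B` with `⟨1, X⟩_{f,ρ_A} = 0 = ⟨1, Y⟩_{f,ρ_B}`
and `⟨X, X⟩_{f,ρ_A} = 1 = ⟨Y, Y⟩_{f,ρ_B}`. The supremum is taken in `[0, ∞]`, so it is `0` if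
there is no such pair. -/
def muLin {A B : Type*} [Fintype A] [DecidableEq A] [Fintype B] [DecidableEq B]
    (f : ℝ → ℝ) (ρ : Matrix (A × B) (A × B) ℂ) : ℝ≥0∞ :=
  ⨆ (X : Matrix A A ℂ) (Y : Matrix B B ℂ)
    (_ : innerJ f (marginalA ρ) 1 X = 0) (_ : innerJ f (marginalB ρ) 1 Y = 0)
    (_ : innerJ f (marginalA ρ) X X = 1) (_ : innerJ f (marginalB ρ) Y Y = 1),
    ‖((X ⊗ₖ Yᴴ) * ρ).trace‖ₑ

/-- The power functions `f_k(x) = x ^ k`. -/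
def powerFun (k : ℝ) : ℝ → ℝ := fun x => x ^ k

/-- The product state `ρ_AB ⊗ σ_A'B'`, seen as a bipartite operator on `AA' : BB'`. -/
def tensorState {A B A' B' : Type*}
    (ρ : Matrix (A × B) (A × B) ℂ) (σ : Matrix (A' × B') (A' × B') ℂ) :
    Matrix ((A × A') × (B × B')) ((A × A') × (B × B')) ℂ :=
  (ρ ⊗ₖ σ).submatrix (Equiv.prodProdProdComm A A' B B') (Equiv.prodProdProdComm A A' B B')

/-- The tensor power `ρ_AB^{⊗ n}`, seen as a bipartite operator on `Aⁿ : Bⁿ`; the space `Aⁿ`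
has the basis `Fin n → A`. -/
def tensorPower {A B : Type*} (n : ℕ) (ρ : Matrix (A × B) (A × B) ℂ) :
    Matrix ((Fin n → A) × (Fin n → B)) ((Fin n → A) × (Fin n → B)) ℂ :=
  Matrix.of fun x y => ∏ i, ρ (x.1 i, x.2 i) (y.1 i, y.2 i)

/-- `ℰ` is `k`-positive: `id ⊗ ℰ` on `k × k` block matrices maps positive semidefinite
matrices to positive semidefinite matrices. -/
def IsKPositive {ι κ : Type*} [Fintype ι] [Fintype κ] (k : ℕ)
    (ℰ : Matrix ι ι ℂ →ₗ[ℂ] Matrix κ κ ℂ) : Prop :=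
  ∀ P : Matrix (Fin k × ι) (Fin k × ι) ℂ, P.PosSemidef →
    (Matrix.of fun x y : Fin k × κ =>
      ℰ (Matrix.of fun a b => P (x.1, a) (y.1, b)) x.2 y.2).PosSemidef

/-- `ℰ` preserves the trace. -/
def IsTracePreserving {ι κ : Type*} [Fintype ι] [Fintype κ]
    (ℰ : Matrix ι ι ℂ →ₗ[ℂ] Matrix κ κ ℂ) : Prop :=
  ∀ X, (ℰ X).trace = X.trace

/-- The action of `ℰ ⊗ ℱ` on a bipartite operator, expanded in matrix units. -/
def tensorMap {A B A' B' : Type*} [Fintype A] [DecidableEq A] [Fintype B] [DecidableEq B]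
    (ℰ : Matrix A A ℂ →ₗ[ℂ] Matrix A' A' ℂ) (ℱ : Matrix B B ℂ →ₗ[ℂ] Matrix B' B' ℂ)
    (M : Matrix (A × B) (A × B) ℂ) : Matrix (A' × B') (A' × B') ℂ :=
  ∑ x : A × B, ∑ y : A × B,
    M x y • (ℰ (Matrix.single x.1 y.1 1) ⊗ₖ ℱ (Matrix.single x.2 y.2 1))

/-- `ρ_AB^{⊗ n}` can be converted to `σ_A'B'` by local two-positive trace-preserving maps. -/
def LocallyConvertible {A B A' B' : Type*} [Fintype A] [DecidableEq A] [Fintype B]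
    [DecidableEq B] [Fintype A'] [Fintype B'] (n : ℕ)
    (ρ : Matrix (A × B) (A × B) ℂ) (σ : Matrix (A' × B') (A' × B') ℂ) : Prop :=
  ∃ (ℰ : Matrix (Fin n → A) (Fin n → A) ℂ →ₗ[ℂ] Matrix A' A' ℂ)
    (ℱ : Matrix (Fin n → B) (Fin n → B) ℂ →ₗ[ℂ] Matrix B' B' ℂ),
    IsKPositive 2 ℰ ∧ IsTracePreserving ℰ ∧ IsKPositive 2 ℱ ∧ IsTracePreserving ℱ ∧
      tensorMap ℰ ℱ (tensorPower n ρ) = σ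

end MaxCorr

end

/-!
The correlation form `B(X, Y) = Tr[(X ⊗ Y*) ρ]` is a contraction for the norms
`‖X‖² = Tr[X* ρ_A^k X ρ_A^(1-k)]` and `‖Y‖² = Tr[Y* ρ_B^k Y ρ_B^(1-k)]`, with
`B(X, 1) = ⟨1, X⟩` and `B(1, Y) = ⟨Y, 1⟩`. So its largest singular value is `1`, attained at the
pair of unit vectors `(1, 1)`, and the maximal correlation is the second singular value of `B`,
that is, the norm of the centred form `B(X, Y) - ⟨1, X⟩ ⟨Y, 1⟩` (`muLin_le_iff`).

Both contractivity statements that are needed, for `B` itself and for the Heisenberg picture of a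
two-positive trace-preserving map, are elementary for `k = 0` and `k = 1`: there they are the
Cauchy–Schwarz inequality and the Schwarz inequality. In eigenbases of the states the norms for
`k = 0` and `k = 1` are weighted `ℓ²` norms with weights `λ_j` and `λ_i` on matrix entries, and the
norm for `k` has the weight `λ_i^k λ_j^(1-k)`. Hence the three lines theorem interpolates between
the two cases (`WBound.interpolate`, `wsq_mulVec_interpolate`). This gives
`norm_trace_kronecker_sq_le_normSqJ` and `normSqJ_adjMap_le`. The latter implies data processing
(`muLin_tensorMap_le`), because the Heisenberg pictures of the local maps preserve the correlation
form and the identity.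

For tensor products, in coordinates `K` and `K'` for which the weights are one, write
`K = u v* + D` and `K' = u' v'* + D'` with the distinguished unit vectors `u, v, u', v'`. Then
`K ⊗ K' - (u ⊗ u')(v ⊗ v')* = D ⊗ K' + u v* ⊗ D'`, where the two terms act between orthogonal
subspaces and `K'` is a contraction, so that the norm is at most `max ‖D‖ ‖D'‖`
(`posSemidef_sq_sub_kronecker`). Elementary tensors with `u', v'` or `u, v` give the reverse
inequality. Iterating, the maximal correlation of a tensor power is at most that of the state, and
data processing finishes the argument.
-/

noncomputable section

namespace MaxCorr

/-! ### Interpolation of weighted bilinear bounds -/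

/-- The weighted square norm `∑ i, w i * |x i|²`. -/
def wsq {I : Type*} [Fintype I] (w : I → ℝ) (x : I → ℂ) : ℝ := ∑ i, w i * ‖x i‖ ^ 2

/-- The bilinear form with matrix `T` has norm at most `c` with respect to the weighted square
norms `wsq w` and `wsq v`. -/
def WBound {I J : Type*} [Fintype I] [Fintype J] (T : Matrix I J ℂ) (w : I → ℝ) (v : J → ℝ)
    (c : ℝ) : Prop :=
  ∀ x y, ‖x ⬝ᵥ T *ᵥ y‖ ^ 2 ≤ c ^ 2 * (wsq w x * wsq v y)

section

variable {I J : Type*}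

/-- The analytic family `x i * (p0 i / p1 i) ^ ((z - k) / 2)` that passes through `x` at `z = k`.
Coordinates where one of the weights vanishes are dropped: there the logarithms mean nothing. -/
def famVec (p0 p1 : I → ℝ) (k : ℝ) (x : I → ℂ) (z : ℂ) (i : I) : ℂ :=
  {i | 0 < p0 i ∧ 0 < p1 i}.indicator x i *
    Complex.exp ((z - k) / 2 * (Real.log (p0 i) - Real.log (p1 i) : ℝ))

lemma famVec_self (p0 p1 : I → ℝ) (k : ℝ) (x : I → ℂ) :
    famVec p0 p1 k x k = {i | 0 < p0 i ∧ 0 < p1 i}.indicator x := by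
  ext i; simp [famVec]

lemma norm_famVec (p0 p1 : I → ℝ) (k : ℝ) (x : I → ℂ) (z : ℂ) (i : I) :
    ‖famVec p0 p1 k x z i‖ = ‖{i | 0 < p0 i ∧ 0 < p1 i}.indicator x i‖ *
      Real.exp ((z.re - k) / 2 * (Real.log (p0 i) - Real.log (p1 i))) := by
  rw [famVec, norm_mul, Complex.norm_exp]
  congr 2
  rw [Complex.re_mul_ofReal]
  simp

lemma norm_famVec_le (p0 p1 : I → ℝ) {k : ℝ} (hk : k ∈ Set.Ioo (0 : ℝ) 1) (x : I → ℂ) {z : ℂ}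
    (hz : z.re ∈ Set.Icc (0 : ℝ) 1) (i : I) :
    ‖famVec p0 p1 k x z i‖ ≤ ‖{i | 0 < p0 i ∧ 0 < p1 i}.indicator x i‖ *
      Real.exp |Real.log (p0 i) - Real.log (p1 i)| := by
  rw [norm_famVec]
  gcongr
  refine (le_abs_self _).trans ?_
  rw [abs_mul]
  refine mul_le_of_le_one_left (abs_nonneg _) ?_
  rw [abs_le]
  constructor <;> linarith [hz.1, hz.2, hk.1, hk.2]

variable [Fintype I] [Fintype J]

lemma wsq_nonneg {w : I → ℝ} (hw : ∀ i, 0 ≤ w i) (x : I → ℂ) : 0 ≤ wsq w x :=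
  Finset.sum_nonneg fun i _ => mul_nonneg (hw i) (by positivity)

lemma wsq_single [DecidableEq I] (w : I → ℝ) (i : I) : wsq w (Pi.single i 1) = w i := by
  simp only [wsq]
  rw [Finset.sum_eq_single i] <;> simp +contextual

/-- Entries of a bounded form vanish where a weight vanishes. -/
lemma WBound.entry_eq_zero {T : Matrix I J ℂ} {w : I → ℝ} {v : J → ℝ} {c : ℝ}
    (h : WBound T w v c) {i : I} {j : J} (hij : w i = 0 ∨ v j = 0) : T i j = 0 := by
  classical
  have := h (Pi.single i 1) (Pi.single j 1)
  rw [wsq_single, wsq_single] at this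
  have h0 : w i * v j = 0 := by rcases hij with h | h <;> simp [h]
  rw [h0, mul_zero, single_dotProduct, Matrix.mulVec_single_one] at this
  simpa using this

/-- A form whose entries vanish outside `s × t` only sees the parts of its arguments on `s`, `t`. -/
lemma dotProduct_mulVec_indicator {T : Matrix I J ℂ} {s : Set I} {t : Set J}
    (hT : ∀ i j, ¬ (i ∈ s ∧ j ∈ t) → T i j = 0) (x : I → ℂ) (y : J → ℂ) :
    s.indicator x ⬝ᵥ T *ᵥ t.indicator y = x ⬝ᵥ T *ᵥ y := by
  classical
  simp only [dotProduct, Matrix.mulVec, Finset.mul_sum]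
  refine Finset.sum_congr rfl fun i _ => Finset.sum_congr rfl fun j _ => ?_
  by_cases h : i ∈ s ∧ j ∈ t
  · simp [h.1, h.2]
  · simp [hT i j h]

/-- On each edge of the strip the norm of the family is the interpolated norm of `x`. -/
lemma wsq_famVec_le {p0 p1 : I → ℝ} (h0 : ∀ i, 0 ≤ p0 i) (h1 : ∀ i, 0 ≤ p1 i) {k : ℝ} (x : I → ℂ)
    (z : ℂ) :
    wsq (fun i => p0 i ^ (1 - z.re) * p1 i ^ z.re) (famVec p0 p1 k x z) ≤
      wsq (fun i => p0 i ^ (1 - k) * p1 i ^ k) x := by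
  refine Finset.sum_le_sum fun i _ => ?_
  rw [norm_famVec]
  by_cases h : 0 < p0 i ∧ 0 < p1 i
  · rw [Set.indicator_of_mem (by exact h)]
    beta_reduce
    rw [mul_pow, ← Real.exp_nat_mul, Real.rpow_def_of_pos h.1, Real.rpow_def_of_pos h.2,
      Real.rpow_def_of_pos h.1, Real.rpow_def_of_pos h.2, ← Real.exp_add, ← Real.exp_add,
      mul_comm (‖x i‖ ^ 2), ← mul_assoc, ← Real.exp_add]
    apply le_of_eq
    congr 2
    push_cast
    ring
  · rw [Set.indicator_of_notMem (by exact h)]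
    simp only [norm_zero, zero_mul, ne_eq, OfNat.ofNat_ne_zero, not_false_eq_true, zero_pow,
      mul_zero]
    have := Real.rpow_nonneg (h0 i) (1 - k)
    have := Real.rpow_nonneg (h1 i) k
    positivity

/-- Interpolation of bilinear bounds between two pairs of weights, by the three lines theorem. -/
theorem WBound.interpolate {T : Matrix I J ℂ} {p0 p1 : I → ℝ} {q0 q1 : J → ℝ}
    (hp0 : ∀ i, 0 ≤ p0 i) (hp1 : ∀ i, 0 ≤ p1 i) (hq0 : ∀ j, 0 ≤ q0 j) (hq1 : ∀ j, 0 ≤ q1 j)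
    (h0 : WBound T p0 q0 1) (h1 : WBound T p1 q1 1) {k : ℝ} (hk : k ∈ Set.Icc (0 : ℝ) 1) :
    WBound T (fun i => p0 i ^ (1 - k) * p1 i ^ k) (fun j => q0 j ^ (1 - k) * q1 j ^ k) 1 := by
  -- At the endpoints `0 ^ 0 = 1`, so the weights are the given ones even where one of them is zero.
  rcases hk.1.eq_or_lt with rfl | hk0
  · simpa using h0
  rcases hk.2.eq_or_lt with rfl | hk1
  · simpa using h1
  intro x y
  set Px := wsq (fun i => p0 i ^ (1 - k) * p1 i ^ k) x
  set Qy := wsq (fun j => q0 j ^ (1 - k) * q1 j ^ k) y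
  have hPx : 0 ≤ Px := wsq_nonneg (fun i => mul_nonneg (Real.rpow_nonneg (hp0 i) _)
    (Real.rpow_nonneg (hp1 i) _)) _
  have hQy : 0 ≤ Qy := wsq_nonneg (fun i => mul_nonneg (Real.rpow_nonneg (hq0 i) _)
    (Real.rpow_nonneg (hq1 i) _)) _
  set F : ℂ → ℂ := fun z => famVec p0 p1 k x z ⬝ᵥ T *ᵥ famVec q0 q1 k y z with hF
  have hdiff : Differentiable ℂ F := by
    simp only [hF, dotProduct, Matrix.mulVec, famVec]
    fun_prop
  have hbdd : BddAbove ((norm ∘ F) '' Complex.HadamardThreeLines.verticalClosedStrip 0 1) := by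
    refine ⟨∑ i, (‖{i | 0 < p0 i ∧ 0 < p1 i}.indicator x i‖ *
      Real.exp |Real.log (p0 i) - Real.log (p1 i)|) * ∑ j, ‖T i j‖ *
        (‖{j | 0 < q0 j ∧ 0 < q1 j}.indicator y j‖ *
          Real.exp |Real.log (q0 j) - Real.log (q1 j)|), ?_⟩
    rintro _ ⟨z, hz, rfl⟩
    have hz' : z.re ∈ Set.Icc (0 : ℝ) 1 := hz
    simp only [Function.comp, hF, dotProduct, Matrix.mulVec]
    refine (norm_sum_le _ _).trans (Finset.sum_le_sum fun i _ => ?_)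
    rw [norm_mul]
    gcongr
    · exact norm_famVec_le _ _ ⟨hk0, hk1⟩ _ hz' _
    · refine (norm_sum_le _ _).trans (Finset.sum_le_sum fun j _ => ?_)
      rw [norm_mul]
      gcongr
      exact norm_famVec_le _ _ ⟨hk0, hk1⟩ _ hz' _
  have edge : ∀ (p : I → ℝ) (q : J → ℝ), (∀ j, 0 ≤ q j) → WBound T p q 1 → ∀ z : ℂ,
      wsq p (famVec p0 p1 k x z) ≤ Px → wsq q (famVec q0 q1 k y z) ≤ Qy →
      ‖F z‖ ≤ √(Px * Qy) := by
    intro p q hq h z h3 h4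
    refine Real.le_sqrt_of_sq_le ((h _ _).trans ?_)
    rw [one_pow, one_mul]
    exact mul_le_mul h3 h4 (wsq_nonneg hq _) hPx
  have key := Complex.HadamardThreeLines.norm_le_interp_of_mem_verticalClosedStrip₀₁' F
    (z := k) (a := √(Px * Qy)) (b := √(Px * Qy)) (by
      simpa [Complex.HadamardThreeLines.verticalClosedStrip] using hk) hdiff.diffContOnCl hbdd
    (fun z hz => edge p0 q0 hq0 h0 z
      (by simpa [show z.re = 0 from hz] using wsq_famVec_le hp0 hp1 (k := k) x z)
      (by simpa [show z.re = 0 from hz] using wsq_famVec_le hq0 hq1 (k := k) y z))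
    (fun z hz => edge p1 q1 hq1 h1 z
      (by simpa [show z.re = 1 from hz] using wsq_famVec_le hp0 hp1 (k := k) x z)
      (by simpa [show z.re = 1 from hz] using wsq_famVec_le hq0 hq1 (k := k) y z))
  -- No coordinate that the family drops contributes to the form.
  have hFk : F k = x ⬝ᵥ T *ᵥ y := by
    simp only [hF, famVec_self]
    refine dotProduct_mulVec_indicator (fun i j hij => ?_) x y
    by_contra hT
    obtain ⟨a, b⟩ := not_or.1 fun h => hT (h0.entry_eq_zero h)
    obtain ⟨a', b'⟩ := not_or.1 fun h => hT (h1.entry_eq_zero h)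
    exact hij ⟨⟨(hp0 i).lt_of_ne' a, (hp1 i).lt_of_ne' a'⟩,
      (hq0 j).lt_of_ne' b, (hq1 j).lt_of_ne' b'⟩
  rw [hFk, Complex.ofReal_re, ← Real.rpow_add' (Real.sqrt_nonneg _) (by simp), sub_add_cancel,
    Real.rpow_one] at key
  rw [one_pow, one_mul, ← Real.sq_sqrt (mul_nonneg hPx hQy)]
  gcongr

/-- Interpolation of norm bounds for a linear map between two pairs of weights. -/
theorem wsq_mulVec_interpolate {V : Matrix J I ℂ} {p0 p1 : I → ℝ} {q0 q1 : J → ℝ}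
    (hp0 : ∀ i, 0 ≤ p0 i) (hp1 : ∀ i, 0 ≤ p1 i) (hq0 : ∀ j, 0 ≤ q0 j) (hq1 : ∀ j, 0 ≤ q1 j)
    (h0 : ∀ x, wsq q0 (V *ᵥ x) ≤ wsq p0 x) (h1 : ∀ x, wsq q1 (V *ᵥ x) ≤ wsq p1 x)
    {k : ℝ} (hk : k ∈ Set.Icc (0 : ℝ) 1) (x : I → ℂ) :
    wsq (fun j => q0 j ^ (1 - k) * q1 j ^ k) (V *ᵥ x) ≤
      wsq (fun i => p0 i ^ (1 - k) * p1 i ^ k) x := by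
  rcases hk.1.eq_or_lt with rfl | hk0
  · simpa using h0 x
  rcases hk.2.eq_or_lt with rfl | hk1
  · simpa using h1 x
  -- The form is cut down to the coordinates where both weights are positive, so that the
  -- inverse weights on its left argument make sense.
  set S : Set J := {j | 0 < q0 j ∧ 0 < q1 j} with hS
  classical
  set T : Matrix J I ℂ := Matrix.of fun j i => if j ∈ S then V j i else 0 with hT
  have hform : ∀ (y : J → ℂ) (x : I → ℂ),
      y ⬝ᵥ T *ᵥ x = ∑ j, if j ∈ S then y j * (V *ᵥ x) j else 0 := by
    intro y x
    refine Finset.sum_congr rfl fun j _ => ?_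
    by_cases hj : j ∈ S <;> simp [Matrix.mulVec, dotProduct, hT, hj]
  have hT_bound : ∀ (p : I → ℝ) (q : J → ℝ), (∀ i, 0 ≤ p i) → (∀ j, 0 ≤ q j) →
      (∀ j ∈ S, 0 < q j) → (∀ x, wsq q (V *ᵥ x) ≤ wsq p x) → WBound T (fun j => (q j)⁻¹) p 1 := by
    intro p q hp hq hqS h y x
    rw [hform, one_pow, one_mul]
    have hle : ‖∑ j, if j ∈ S then y j * (V *ᵥ x) j else 0‖ ≤
        ∑ j, (√((q j)⁻¹) * ‖y j‖) * (√(q j) * ‖(V *ᵥ x) j‖) := by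
      refine (norm_sum_le _ _).trans (Finset.sum_le_sum fun j _ => ?_)
      by_cases hj : j ∈ S
      · have : √((q j)⁻¹) * √(q j) = 1 := by
          rw [← Real.sqrt_mul (inv_nonneg.2 (hq j)), inv_mul_cancel₀ (hqS j hj).ne', Real.sqrt_one]
        rw [if_pos hj, norm_mul]
        apply le_of_eq
        linear_combination (-‖y j‖ * ‖(V *ᵥ x) j‖) * this
      · simp only [hj, if_false, norm_zero]; positivity
    calc _ ≤ (∑ j, (√((q j)⁻¹) * ‖y j‖) * (√(q j) * ‖(V *ᵥ x) j‖)) ^ 2 := by gcongr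
      _ ≤ _ := Finset.sum_mul_sq_le_sq_mul_sq _ _ _
      _ = wsq (fun j => (q j)⁻¹) y * wsq q (V *ᵥ x) := by
        simp only [wsq, mul_pow]
        congr 1 <;> refine Finset.sum_congr rfl fun j _ => ?_
        · rw [Real.sq_sqrt (inv_nonneg.2 (hq j))]
        · rw [Real.sq_sqrt (hq j)]
      _ ≤ _ := by
        gcongr
        · exact wsq_nonneg (fun j => inv_nonneg.2 (hq j)) _
        · exact h x
  have hk_bound := (hT_bound p0 q0 hp0 hq0 (fun j hj => hj.1) h0).interpolate
    (fun j => inv_nonneg.2 (hq0 j)) (fun j => inv_nonneg.2 (hq1 j)) hp0 hp1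
    (hT_bound p1 q1 hp1 hq1 (fun j hj => hj.2) h1) hk
  set qk : J → ℝ := fun j => q0 j ^ (1 - k) * q1 j ^ k with hqk
  have hqk_nn : ∀ j, 0 ≤ qk j := fun j =>
    mul_nonneg (Real.rpow_nonneg (hq0 j) _) (Real.rpow_nonneg (hq1 j) _)
  have hqk_zero : ∀ j, j ∉ S → qk j = 0 := by
    intro j hj
    by_contra hne
    refine hj ⟨(hq0 j).lt_of_ne' fun h => hne ?_, (hq1 j).lt_of_ne' fun h => hne ?_⟩
    · simp [hqk, h, Real.zero_rpow (sub_pos.2 hk1).ne']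
    · simp [hqk, h, Real.zero_rpow hk0.ne']
  have hinv : ∀ j, (q0 j)⁻¹ ^ (1 - k) * (q1 j)⁻¹ ^ k = (qk j)⁻¹ := by
    intro j
    rw [hqk, mul_inv, Real.inv_rpow (hq0 j), Real.inv_rpow (hq1 j)]
  simp only [hinv] at hk_bound
  -- The form is tested on the vector dual to `V *ᵥ x`.
  have key := hk_bound (fun j => (qk j : ℂ) * star ((V *ᵥ x) j)) x
  have e1 : (fun j => (qk j : ℂ) * star ((V *ᵥ x) j)) ⬝ᵥ T *ᵥ x = (wsq qk (V *ᵥ x) : ℝ) := by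
    rw [hform, wsq, Complex.ofReal_sum]
    refine Finset.sum_congr rfl fun j _ => ?_
    by_cases hj : j ∈ S
    · rw [if_pos hj, mul_assoc, Complex.star_def, Complex.conj_mul']
      push_cast
      rfl
    · simp [hj, hqk_zero j hj]
  have e2 : wsq (fun j => (qk j)⁻¹) (fun j => (qk j : ℂ) * star ((V *ᵥ x) j)) =
      wsq qk (V *ᵥ x) := by
    refine Finset.sum_congr rfl fun j _ => ?_
    rw [norm_mul, norm_star, Complex.norm_real, Real.norm_of_nonneg (hqk_nn j)]
    rcases eq_or_ne (qk j) 0 with h | h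
    · simp [h]
    · field_simp
  rw [e1, e2, Complex.norm_real, Real.norm_of_nonneg (wsq_nonneg hqk_nn _), one_pow, one_mul,
    sq] at key
  rcases (wsq_nonneg hqk_nn (V *ᵥ x)).eq_or_lt with h | h
  · rw [← h]
    exact wsq_nonneg (fun i => mul_nonneg (Real.rpow_nonneg (hp0 i) _)
      (Real.rpow_nonneg (hp1 i) _)) _
  · exact le_of_mul_le_mul_left key h

end

/-! ### The inner product of a state in an arbitrary eigenbasis -/

/-- The limits in the definition of the perspective function match the convention `0 ^ 0 = 1`. -/
lemma perspective_powerFun {k : ℝ} (hk : k ∈ Set.Icc (0 : ℝ) 1) {x y : ℝ} (hx : 0 ≤ x)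
    (hy : 0 ≤ y) : perspective (powerFun k) x y = y ^ (1 - k) * x ^ k := by
  unfold perspective powerFun
  split_ifs with h1 h2
  · subst h1
    have : Tendsto (fun x : ℝ => x ^ k) (𝓝[>] 0) (𝓝 (0 ^ k)) :=
      (Real.continuousAt_rpow_const _ _ (Or.inr hk.1)).tendsto.mono_left nhdsWithin_le_nhds
    rw [this.limUnder_eq]
    rcases hk.1.eq_or_lt with rfl | hk0
    · simp
    · simp [Real.zero_rpow hk0.ne']
  · subst h2
    have hpos : ∀ᶠ t : ℝ in atTop, t ^ (k - 1) = t ^ k / t := by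
      filter_upwards [eventually_gt_atTop 0] with t ht
      rw [Real.rpow_sub_one ht.ne']
    rcases hk.2.eq_or_lt with rfl | hk1
    · have : Tendsto (fun t : ℝ => t ^ (1 : ℝ) / t) atTop (𝓝 1) := by
        refine Tendsto.congr' hpos ?_
        simp
      rw [this.limUnder_eq]
      simp
    · have : Tendsto (fun t : ℝ => t ^ k / t) atTop (𝓝 0) := by
        refine Tendsto.congr' hpos ?_
        rw [show k - 1 = -(1 - k) by ring]
        exact tendsto_rpow_neg_atTop (sub_pos.2 hk1)
      rw [this.limUnder_eq, Real.zero_rpow (sub_pos.2 hk1).ne']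
      simp
  · have hx' := hx.lt_of_ne' h1
    have hy' := hy.lt_of_ne' h2
    rw [Real.div_rpow hx hy, Real.rpow_sub hy', Real.rpow_one]
    field_simp

lemma trace_conjTranspose_mul {κ : Type*} [Fintype κ] (X Y : Matrix κ κ ℂ) :
    (Xᴴ * Y).trace = ∑ i, ∑ j, star (X i j) * Y i j := by
  rw [Finset.sum_comm]
  rfl

section

variable {ι κ : Type*} [Fintype ι] [DecidableEq ι] [Fintype κ] [DecidableEq κ]

/-- The columns of `U` form an orthonormal basis of eigenvectors of `σ`, with eigenvalues `d`.
The basis may be indexed by another type than the coordinates. -/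
structure Diagonalizes (U : Matrix ι κ ℂ) (d : κ → ℝ) (σ : Matrix ι ι ℂ) : Prop where
  left : Uᴴ * U = 1
  right : U * Uᴴ = 1
  eq : σ = U * Matrix.diagonal (fun i => (d i : ℂ)) * Uᴴ

lemma diagonalizes_eigenvectorUnitary {σ : Matrix ι ι ℂ} (hσ : σ.IsHermitian) :
    Diagonalizes (hσ.eigenvectorUnitary : Matrix ι ι ℂ) hσ.eigenvalues σ where
  left := Unitary.coe_star_mul_self hσ.eigenvectorUnitary
  right := Unitary.coe_mul_star_self hσ.eigenvectorUnitary
  eq := by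
    conv_lhs => rw [hσ.spectral_theorem]
    rfl

lemma Diagonalizes.nonneg {U : Matrix ι κ ℂ} {d : κ → ℝ} {σ : Matrix ι ι ℂ}
    (h : Diagonalizes U d σ) (hσ : σ.PosSemidef) (i : κ) : 0 ≤ d i := by
  have h1 := (hσ.conjTranspose_mul_mul_same U).diag_nonneg (i := i)
  rw [h.eq, show Uᴴ * (U * Matrix.diagonal (fun i => (d i : ℂ)) * Uᴴ) * U =
    (Uᴴ * U) * Matrix.diagonal (fun i => (d i : ℂ)) * (Uᴴ * U) by simp only [Matrix.mul_assoc],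
    h.left, Matrix.one_mul, Matrix.mul_one, Matrix.diagonal_apply_eq] at h1
  exact_mod_cast h1

lemma innerJ_eigenvectorUnitary (f : ℝ → ℝ) {σ : Matrix ι ι ℂ} (hσ : σ.IsHermitian)
    (X Y : Matrix ι ι ℂ) :
    innerJ f σ X Y = ∑ i, ∑ j, star (((hσ.eigenvectorUnitary : Matrix ι ι ℂ)ᴴ * X *
      (hσ.eigenvectorUnitary : Matrix ι ι ℂ)) i j) *
      ((perspective f (hσ.eigenvalues i) (hσ.eigenvalues j) : ℝ) *
        ((hσ.eigenvectorUnitary : Matrix ι ι ℂ)ᴴ * Y *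
          (hσ.eigenvectorUnitary : Matrix ι ι ℂ)) i j) := by
  set V : Matrix ι ι ℂ := (hσ.eigenvectorUnitary : Matrix ι ι ℂ) with hV
  have hQ : ∀ i, eigenProj hσ i = V * Matrix.single i i 1 * Vᴴ := by
    intro i
    ext a b
    simp [eigenProj, Matrix.vecMulVec_apply, Matrix.mul_apply, Matrix.single_apply, hV, ite_and]
  have hent : ∀ (Z : Matrix ι ι ℂ) i j, Matrix.single i i (1 : ℂ) * (Vᴴ * Z * V) *
      Matrix.single j j 1 = (Vᴴ * Z * V) i j • Matrix.single i j 1 := by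
    intro Z i j
    rw [Matrix.single_mul_mul_single]
    simp
  rw [innerJ, Jop, dif_pos hσ, Finset.mul_sum, Matrix.trace_sum]
  refine Finset.sum_congr rfl fun i _ => ?_
  rw [Finset.mul_sum, Matrix.trace_sum]
  refine Finset.sum_congr rfl fun j _ => ?_
  rw [Matrix.mul_smul, Matrix.trace_smul, hQ, hQ, smul_eq_mul,
    show V * Matrix.single i i 1 * Vᴴ * Y * (V * Matrix.single j j 1 * Vᴴ) =
      V * (Matrix.single i i 1 * (Vᴴ * Y * V) * Matrix.single j j 1) * Vᴴ by
      simp only [Matrix.mul_assoc], hent, Matrix.mul_smul, Matrix.smul_mul, Matrix.mul_smul,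
    Matrix.trace_smul, ← Matrix.mul_assoc, Matrix.trace_mul_comm, ← Matrix.mul_assoc,
    ← Matrix.mul_assoc, Matrix.trace_mul_single]
  have : (Vᴴ * Xᴴ * V) j i = star ((Vᴴ * X * V) i j) := by
    rw [← Matrix.conjTranspose_apply, Matrix.conjTranspose_mul, Matrix.conjTranspose_mul,
      Matrix.conjTranspose_conjTranspose, Matrix.mul_assoc]
  rw [this, smul_eq_mul]
  simp
  ring

/-- The inner product can be computed in any orthonormal eigenbasis of the state. -/
theorem Diagonalizes.innerJ_eq {U : Matrix ι κ ℂ} {d : κ → ℝ} {σ : Matrix ι ι ℂ}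
    (h : Diagonalizes U d σ) (f : ℝ → ℝ) (X Y : Matrix ι ι ℂ) :
    innerJ f σ X Y = ∑ i, ∑ j, star ((Uᴴ * X * U) i j) *
      ((perspective f (d i) (d j) : ℝ) * (Uᴴ * Y * U) i j) := by
  have hσ : σ.IsHermitian := by
    rw [h.eq, Matrix.IsHermitian]
    simp [Matrix.mul_assoc, Matrix.diagonal_conjTranspose, Pi.star_def]
  have hV := diagonalizes_eigenvectorUnitary hσ
  rw [innerJ_eigenvectorUnitary f hσ]
  generalize (hσ.eigenvectorUnitary : Matrix ι ι ℂ) = V at hV ⊢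
  generalize hσ.eigenvalues = e at hV ⊢
  -- The transition matrix between the two eigenbases only relates equal eigenvalues.
  set S : Matrix ι κ ℂ := Vᴴ * U with hS
  have hSS : Sᴴ * S = 1 := by
    rw [hS, Matrix.conjTranspose_mul, Matrix.conjTranspose_conjTranspose, Matrix.mul_assoc,
      ← Matrix.mul_assoc V, hV.right, Matrix.one_mul, h.left]
  have hinter : Matrix.diagonal (fun i => (e i : ℂ)) * S =
      S * Matrix.diagonal (fun i => (d i : ℂ)) := by
    have h1 : Vᴴ * σ * U = Matrix.diagonal (fun i => (e i : ℂ)) * S := by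
      rw [hV.eq, hS]
      simp only [← Matrix.mul_assoc]
      rw [hV.left, Matrix.one_mul]
    have h2 : Vᴴ * σ * U = S * Matrix.diagonal (fun i => (d i : ℂ)) := by
      rw [h.eq, hS]
      simp only [Matrix.mul_assoc]
      rw [h.left, Matrix.mul_one]
    exact h1.symm.trans h2
  have hentry : ∀ i j, S i j ≠ 0 → e i = d j := by
    intro i j hij
    have := congrFun (congrFun hinter i) j
    rw [Matrix.diagonal_mul, Matrix.mul_diagonal, mul_comm] at this
    exact_mod_cast mul_left_cancel₀ hij this
  have htrans : ∀ Z : Matrix ι ι ℂ, Vᴴ * Z * V = S * (Uᴴ * Z * U) * Sᴴ := by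
    intro Z
    rw [hS, Matrix.conjTranspose_mul, Matrix.conjTranspose_conjTranspose,
      show Vᴴ * U * (Uᴴ * Z * U) * (Uᴴ * V) = Vᴴ * (U * Uᴴ) * Z * (U * Uᴴ) * V by
        simp only [Matrix.mul_assoc], h.right, Matrix.mul_one, Matrix.mul_one]
  have hweight : ∀ N : Matrix κ κ ℂ,
      (Matrix.of fun i j : ι => ((perspective f (e i) (e j) : ℝ) : ℂ) * (S * N * Sᴴ) i j) =
      S * (Matrix.of fun i j : κ => ((perspective f (d i) (d j) : ℝ) : ℂ) * N i j) * Sᴴ := by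
    intro N
    ext i j
    rw [Matrix.of_apply, Matrix.mul_apply, Matrix.mul_apply, Finset.mul_sum]
    refine Finset.sum_congr rfl fun l _ => ?_
    rw [Matrix.mul_apply, Matrix.mul_apply, Finset.sum_mul, Finset.sum_mul, Finset.mul_sum]
    refine Finset.sum_congr rfl fun m _ => ?_
    rw [Matrix.conjTranspose_apply]
    by_cases h1 : S i m = 0
    · simp [h1]
    by_cases h2 : S j l = 0
    · simp [h2]
    rw [Matrix.of_apply, hentry i m h1, hentry j l h2]
    ring
  clear_value S
  have e1 := trace_conjTranspose_mul (Vᴴ * X * V)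
    (Matrix.of fun i j : ι => ((perspective f (e i) (e j) : ℝ) : ℂ) * (Vᴴ * Y * V) i j)
  have e2 := trace_conjTranspose_mul (Uᴴ * X * U)
    (Matrix.of fun i j : κ => ((perspective f (d i) (d j) : ℝ) : ℂ) * (Uᴴ * Y * U) i j)
  simp only [Matrix.of_apply] at e1 e2
  rw [← e1, ← e2, htrans Y, htrans X]
  generalize Uᴴ * X * U = M
  generalize Uᴴ * Y * U = N
  rw [hweight]
  generalize (Matrix.of fun i j : κ => ((perspective f (d i) (d j) : ℝ) : ℂ) * N i j) = N'
  rw [Matrix.conjTranspose_mul, Matrix.conjTranspose_mul, Matrix.conjTranspose_conjTranspose,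
    ← Matrix.mul_assoc, Matrix.trace_mul_comm,
    show Sᴴ * (S * (Mᴴ * Sᴴ) * (S * N')) = (Sᴴ * S) * Mᴴ * (Sᴴ * S) * N' by
      simp only [Matrix.mul_assoc], hSS, Matrix.one_mul, Matrix.mul_one]

lemma Jop_sub (f : ℝ → ℝ) (σ X Y : Matrix ι ι ℂ) : Jop f σ (X - Y) = Jop f σ X - Jop f σ Y := by
  unfold Jop
  split_ifs
  · simp only [mul_sub, sub_mul, smul_sub, Finset.sum_sub_distrib]
  · simp

lemma Jop_smul (f : ℝ → ℝ) (σ : Matrix ι ι ℂ) (c : ℂ) (X : Matrix ι ι ℂ) :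
    Jop f σ (c • X) = c • Jop f σ X := by
  unfold Jop
  split_ifs
  · simp only [Matrix.mul_smul, Matrix.smul_mul, smul_comm _ c, Finset.smul_sum]
  · simp

lemma innerJ_sub_left (f : ℝ → ℝ) (σ X Y Z : Matrix ι ι ℂ) :
    innerJ f σ (X - Y) Z = innerJ f σ X Z - innerJ f σ Y Z := by
  simp [innerJ, sub_mul]

lemma innerJ_sub_right (f : ℝ → ℝ) (σ X Y Z : Matrix ι ι ℂ) :
    innerJ f σ X (Y - Z) = innerJ f σ X Y - innerJ f σ X Z := by
  simp [innerJ, mul_sub, Jop_sub]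

lemma innerJ_smul_left (f : ℝ → ℝ) (σ : Matrix ι ι ℂ) (c : ℂ) (X Y : Matrix ι ι ℂ) :
    innerJ f σ (c • X) Y = star c * innerJ f σ X Y := by
  simp [innerJ]

lemma innerJ_smul_right (f : ℝ → ℝ) (σ : Matrix ι ι ℂ) (c : ℂ) (X Y : Matrix ι ι ℂ) :
    innerJ f σ X (c • Y) = c * innerJ f σ X Y := by
  simp [innerJ, Jop_smul]

lemma rpow_one_sub_mul_rpow {x : ℝ} (hx : 0 ≤ x) (k : ℝ) : x ^ (1 - k) * x ^ k = x := by
  rw [← Real.rpow_add' hx (by simp), sub_add_cancel, Real.rpow_one]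

/-- The square norm `⟨X, X⟩` of `X` with respect to the `k`-th power function. -/
def normSqJ (k : ℝ) (σ X : Matrix ι ι ℂ) : ℝ := (innerJ (powerFun k) σ X X).re

variable {U : Matrix ι κ ℂ} {d : κ → ℝ} {σ : Matrix ι ι ℂ} {k : ℝ}

lemma Diagonalizes.innerJ_self (h : Diagonalizes U d σ) (hσ : σ.PosSemidef)
    (hk : k ∈ Set.Icc (0 : ℝ) 1) (X : Matrix ι ι ℂ) :
    innerJ (powerFun k) σ X X =
      (wsq (fun p : κ × κ => d p.2 ^ (1 - k) * d p.1 ^ k) (fun p => (Uᴴ * X * U) p.1 p.2) : ℝ) := by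
  rw [h.innerJ_eq, wsq, Fintype.sum_prod_type, Complex.ofReal_sum]
  refine Finset.sum_congr rfl fun i _ => ?_
  rw [Complex.ofReal_sum]
  refine Finset.sum_congr rfl fun j _ => ?_
  rw [perspective_powerFun hk (h.nonneg hσ i) (h.nonneg hσ j), mul_left_comm, Complex.star_def,
    Complex.conj_mul']
  push_cast
  rfl

lemma Diagonalizes.normSqJ_eq (h : Diagonalizes U d σ) (hσ : σ.PosSemidef)
    (hk : k ∈ Set.Icc (0 : ℝ) 1) (X : Matrix ι ι ℂ) :
    normSqJ k σ X =
      wsq (fun p : κ × κ => d p.2 ^ (1 - k) * d p.1 ^ k) (fun p => (Uᴴ * X * U) p.1 p.2) := by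
  rw [normSqJ, h.innerJ_self hσ hk, Complex.ofReal_re]

lemma innerJ_self (hσ : σ.PosSemidef) (hk : k ∈ Set.Icc (0 : ℝ) 1) (X : Matrix ι ι ℂ) :
    innerJ (powerFun k) σ X X = normSqJ k σ X := by
  have h := diagonalizes_eigenvectorUnitary hσ.isHermitian
  rw [h.normSqJ_eq hσ hk, h.innerJ_self hσ hk]

lemma normSqJ_nonneg (hσ : σ.PosSemidef) (hk : k ∈ Set.Icc (0 : ℝ) 1) (X : Matrix ι ι ℂ) :
    0 ≤ normSqJ k σ X := by
  have h := diagonalizes_eigenvectorUnitary hσ.isHermitian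
  rw [h.normSqJ_eq hσ hk]
  exact wsq_nonneg (fun p => mul_nonneg (Real.rpow_nonneg (h.nonneg hσ _) _)
    (Real.rpow_nonneg (h.nonneg hσ _) _)) _

/-- On the identity the inner product is `Tr[X σ]`, whatever the value of `k`. -/
lemma innerJ_one_left (hσ : σ.PosSemidef) (hk : k ∈ Set.Icc (0 : ℝ) 1) (X : Matrix ι ι ℂ) :
    innerJ (powerFun k) σ 1 X = (X * σ).trace := by
  have h := diagonalizes_eigenvectorUnitary hσ.isHermitian
  rw [h.innerJ_eq]
  generalize hσ.isHermitian.eigenvalues = d at h ⊢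
  generalize (hσ.isHermitian.eigenvectorUnitary : Matrix ι ι ℂ) = U at h ⊢
  rw [Matrix.mul_one, h.left]
  conv_rhs => rw [h.eq, Matrix.trace_mul_comm, Matrix.mul_assoc, Matrix.mul_assoc,
    Matrix.trace_mul_comm, Matrix.mul_assoc, Matrix.trace]
  refine Finset.sum_congr rfl fun i _ => ?_
  rw [Finset.sum_eq_single i (fun j _ hj => by simp [Matrix.one_apply_ne hj.symm]) (by simp),
    perspective_powerFun hk (h.nonneg hσ i) (h.nonneg hσ i),
    rpow_one_sub_mul_rpow (h.nonneg hσ i)]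
  simp [Matrix.mul_assoc]

lemma innerJ_conj_symm (f : ℝ → ℝ) (hσ : σ.IsHermitian) (X Y : Matrix ι ι ℂ) :
    star (innerJ f σ X Y) = innerJ f σ Y X := by
  have h := diagonalizes_eigenvectorUnitary hσ
  rw [h.innerJ_eq, h.innerJ_eq]
  simp only [star_sum, star_mul', star_star]
  refine Finset.sum_congr rfl fun i _ => Finset.sum_congr rfl fun j _ => ?_
  simp only [Complex.star_def, Complex.conj_ofReal]
  ring

lemma normSqJ_sub_smul_one (hσ : σ.PosSemidef) (htr : σ.trace = 1) (hk : k ∈ Set.Icc (0 : ℝ) 1)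
    (X : Matrix ι ι ℂ) :
    normSqJ k σ (X - innerJ (powerFun k) σ 1 X • 1) =
      normSqJ k σ X - ‖innerJ (powerFun k) σ 1 X‖ ^ 2 := by
  have h : innerJ (powerFun k) σ X 1 = star (innerJ (powerFun k) σ 1 X) :=
    (innerJ_conj_symm _ hσ.isHermitian _ _).symm
  have h1 : innerJ (powerFun k) σ 1 1 = 1 := by rw [innerJ_one_left hσ hk, Matrix.one_mul, htr]
  have h2 : innerJ (powerFun k) σ (X - innerJ (powerFun k) σ 1 X • 1)
      (X - innerJ (powerFun k) σ 1 X • 1) =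
      normSqJ k σ X - (‖innerJ (powerFun k) σ 1 X‖ : ℂ) ^ 2 := by
    rw [innerJ_sub_left, innerJ_sub_right, innerJ_sub_right, innerJ_smul_left, innerJ_smul_right,
      innerJ_smul_left, innerJ_smul_right, h, h1, innerJ_self hσ hk, ← Complex.conj_mul',
      Complex.star_def]
    ring
  rw [innerJ_self hσ hk] at h2
  exact_mod_cast h2

lemma innerJ_one_sub_smul_one (hσ : σ.PosSemidef) (htr : σ.trace = 1)
    (hk : k ∈ Set.Icc (0 : ℝ) 1) (X : Matrix ι ι ℂ) :
    innerJ (powerFun k) σ 1 (X - innerJ (powerFun k) σ 1 X • 1) = 0 := by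
  have h1 : innerJ (powerFun k) σ 1 1 = 1 := by rw [innerJ_one_left hσ hk, Matrix.one_mul, htr]
  rw [innerJ_sub_right, innerJ_smul_right, h1]
  ring

end

/-! ### Marginals and the correlation form -/

section

variable {A B : Type*} [Fintype A] [DecidableEq A] [Fintype B] [DecidableEq B]

omit [DecidableEq A] in
lemma trace_mul_marginalA (X : Matrix A A ℂ) (ρ : Matrix (A × B) (A × B) ℂ) :
    (X * marginalA ρ).trace = ((X ⊗ₖ (1 : Matrix B B ℂ)) * ρ).trace := by
  simp only [Matrix.trace, Matrix.diag, Matrix.mul_apply, marginalA, Matrix.of_apply,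
    Fintype.sum_prod_type, Matrix.kronecker_apply, Finset.mul_sum]
  refine Finset.sum_congr rfl fun a _ => ?_
  rw [Finset.sum_comm]
  refine Finset.sum_congr rfl fun b _ => Finset.sum_congr rfl fun a' _ => ?_
  rw [Finset.sum_eq_single b (fun b' _ hb => by simp [Matrix.one_apply_ne hb.symm]) (by simp)]
  simp

omit [DecidableEq B] in
lemma trace_mul_marginalB (Y : Matrix B B ℂ) (ρ : Matrix (A × B) (A × B) ℂ) :
    (Y * marginalB ρ).trace = (((1 : Matrix A A ℂ) ⊗ₖ Y) * ρ).trace := by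
  simp only [Matrix.trace, Matrix.diag, Matrix.mul_apply, marginalB, Matrix.of_apply,
    Fintype.sum_prod_type, Matrix.kronecker_apply, Finset.mul_sum]
  rw [Finset.sum_comm (s := (Finset.univ : Finset A))]
  refine Finset.sum_congr rfl fun b _ => ?_
  rw [Finset.sum_comm]
  refine Finset.sum_congr rfl fun a _ => ?_
  rw [Finset.sum_eq_single a (fun a' _ ha => by simp [Matrix.one_apply_ne ha.symm]) (by simp)]
  simp

omit [Fintype A] [DecidableEq A] [DecidableEq B] in
lemma posSemidef_marginalA {ρ : Matrix (A × B) (A × B) ℂ} (hρ : ρ.PosSemidef) :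
    (marginalA ρ).PosSemidef := by
  have : marginalA ρ = ∑ b, ρ.submatrix (fun a => (a, b)) (fun a => (a, b)) := by
    ext a a'
    simp [marginalA, Matrix.sum_apply]
  rw [this]
  exact Matrix.posSemidef_sum _ fun b _ => hρ.submatrix _

omit [DecidableEq A] [Fintype B] [DecidableEq B] in
lemma posSemidef_marginalB {ρ : Matrix (A × B) (A × B) ℂ} (hρ : ρ.PosSemidef) :
    (marginalB ρ).PosSemidef := by
  have : marginalB ρ = ∑ a, ρ.submatrix (fun b => (a, b)) (fun b => (a, b)) := by
    ext a a'
    simp [marginalB, Matrix.sum_apply]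
  rw [this]
  exact Matrix.posSemidef_sum _ fun b _ => hρ.submatrix _

lemma IsState.marginalA {ρ : Matrix (A × B) (A × B) ℂ} (hρ : IsState ρ) :
    IsState (marginalA ρ) := by
  refine ⟨posSemidef_marginalA hρ.1, ?_⟩
  rw [← Matrix.one_mul (MaxCorr.marginalA ρ), trace_mul_marginalA, Matrix.one_kronecker_one,
    Matrix.one_mul, hρ.2]

lemma IsState.marginalB {ρ : Matrix (A × B) (A × B) ℂ} (hρ : IsState ρ) :
    IsState (marginalB ρ) := by
  refine ⟨posSemidef_marginalB hρ.1, ?_⟩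
  rw [← Matrix.one_mul (MaxCorr.marginalB ρ), trace_mul_marginalB, Matrix.one_kronecker_one,
    Matrix.one_mul, hρ.2]

omit [DecidableEq A] [DecidableEq B] in
lemma trace_kronecker_mul (X : Matrix A A ℂ) (Y : Matrix B B ℂ)
    (ρ : Matrix (A × B) (A × B) ℂ) : ((X ⊗ₖ Y) * ρ).trace =
      ∑ p : A × A, ∑ q : B × B, X p.1 p.2 * Y q.1 q.2 * ρ (p.2, q.2) (p.1, q.1) := by
  simp only [Matrix.trace, Matrix.diag, Matrix.mul_apply, Fintype.sum_prod_type,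
    Matrix.kronecker_apply]
  refine Finset.sum_congr rfl fun a _ => ?_
  rw [Finset.sum_comm]

open scoped MatrixOrder in
lemma exists_eq_mul_conjTranspose {ι : Type*} [Fintype ι] [DecidableEq ι] {ρ : Matrix ι ι ℂ}
    (hρ : ρ.PosSemidef) : ∃ C : Matrix ι ι ℂ, ρ = C * Cᴴ := by
  obtain ⟨D, hD⟩ := CStarAlgebra.nonneg_iff_eq_star_mul_self.1 hρ.nonneg
  exact ⟨Dᴴ, by rw [Matrix.conjTranspose_conjTranspose]; exact hD⟩

/-- Cauchy–Schwarz for the form `Tr[Xᴴ Y ρ]` of a positive semidefinite `ρ`. -/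
lemma norm_trace_mul_sq_le {ι : Type*} [Fintype ι] {ρ : Matrix ι ι ℂ} (hρ : ρ.PosSemidef)
    (X Y : Matrix ι ι ℂ) :
    ‖(Xᴴ * Y * ρ).trace‖ ^ 2 ≤ (Xᴴ * X * ρ).trace.re * (Yᴴ * Y * ρ).trace.re := by
  classical
  obtain ⟨C, rfl⟩ := exists_eq_mul_conjTranspose hρ
  have h : ∀ X Y : Matrix ι ι ℂ, (Xᴴ * Y * (C * Cᴴ)).trace =
      ∑ i, ∑ j, star ((X * C) i j) * (Y * C) i j := by
    intro X Y
    rw [← trace_conjTranspose_mul, Matrix.conjTranspose_mul, ← Matrix.mul_assoc,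
      Matrix.trace_mul_comm]
    simp only [Matrix.mul_assoc]
  have hs : ∀ X : Matrix ι ι ℂ, (Xᴴ * X * (C * Cᴴ)).trace.re =
      ∑ p : ι × ι, ‖(X * C) p.1 p.2‖ ^ 2 := by
    intro X
    rw [h, Fintype.sum_prod_type, Complex.re_sum]
    refine Finset.sum_congr rfl fun i _ => ?_
    rw [Complex.re_sum]
    refine Finset.sum_congr rfl fun j _ => ?_
    rw [Complex.star_def, Complex.conj_mul']
    norm_cast
  rw [hs, hs, h, ← Fintype.sum_prod_type']
  calc _ ≤ (∑ p : ι × ι, ‖(X * C) p.1 p.2‖ * ‖(Y * C) p.1 p.2‖) ^ 2 := by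
        gcongr
        refine (norm_sum_le _ _).trans (le_of_eq (Finset.sum_congr rfl fun p _ => ?_))
        rw [norm_mul, norm_star]
    _ ≤ _ := Finset.sum_mul_sq_le_sq_mul_sq _ _ _

/-- The correlation form is bounded by the norms given by `X ↦ Tr[X* X ρ_A]`. -/
lemma norm_trace_kronecker_sq_le {ρ : Matrix (A × B) (A × B) ℂ} (hρ : ρ.PosSemidef)
    (X : Matrix A A ℂ) (Y : Matrix B B ℂ) :
    ‖((X ⊗ₖ Yᴴ) * ρ).trace‖ ^ 2 ≤
      (Xᴴ * X * marginalA ρ).trace.re * (Yᴴ * Y * marginalB ρ).trace.re := by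
  have h := norm_trace_mul_sq_le hρ ((1 : Matrix A A ℂ) ⊗ₖ Y) (X ⊗ₖ (1 : Matrix B B ℂ))
  simp only [Matrix.conjTranspose_kronecker, ← Matrix.mul_kronecker_mul,
    Matrix.conjTranspose_one, Matrix.one_mul, Matrix.mul_one] at h
  rw [← trace_mul_marginalA, ← trace_mul_marginalB, mul_comm (Complex.re _)] at h
  exact h

/-- The correlation form is bounded by the norms given by `X ↦ Tr[X X* ρ_A]`. -/
lemma norm_trace_kronecker_sq_le' {ρ : Matrix (A × B) (A × B) ℂ} (hρ : ρ.PosSemidef)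
    (X : Matrix A A ℂ) (Y : Matrix B B ℂ) :
    ‖((X ⊗ₖ Yᴴ) * ρ).trace‖ ^ 2 ≤
      (X * Xᴴ * marginalA ρ).trace.re * (Y * Yᴴ * marginalB ρ).trace.re := by
  have h := norm_trace_mul_sq_le hρ (Xᴴ ⊗ₖ (1 : Matrix B B ℂ)) ((1 : Matrix A A ℂ) ⊗ₖ Yᴴ)
  simp only [Matrix.conjTranspose_kronecker, ← Matrix.mul_kronecker_mul,
    Matrix.conjTranspose_one, Matrix.one_mul, Matrix.mul_one,
    Matrix.conjTranspose_conjTranspose] at h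
  rw [← trace_mul_marginalA, ← trace_mul_marginalB] at h
  exact h

end

section

variable {ι κ : Type*} [Fintype ι] [DecidableEq ι] [Fintype κ] [DecidableEq κ]
  {U : Matrix ι κ ℂ} {d : κ → ℝ} {σ : Matrix ι ι ℂ}

/-- The norm for `k = 0` in an eigenbasis. -/
lemma Diagonalizes.trace_conjTranspose_mul_mul (h : Diagonalizes U d σ) (X : Matrix ι ι ℂ) :
    (Xᴴ * X * σ).trace.re =
      wsq (fun p : κ × κ => d p.2) (fun p => (Uᴴ * X * U) p.1 p.2) := by
  have : (Xᴴ * X * σ).trace = ((Uᴴ * X * U)ᴴ * ((Uᴴ * X * U) *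
      Matrix.diagonal (fun i => (d i : ℂ)))).trace := by
    rw [Matrix.conjTranspose_mul, Matrix.conjTranspose_mul, Matrix.conjTranspose_conjTranspose,
      show Uᴴ * (Xᴴ * U) * (Uᴴ * X * U * Matrix.diagonal (fun i => (d i : ℂ))) =
        Uᴴ * (Xᴴ * (U * Uᴴ) * X * U * Matrix.diagonal (fun i => (d i : ℂ))) by
        simp only [Matrix.mul_assoc], h.right, Matrix.mul_one, Matrix.trace_mul_comm Uᴴ]
    conv_lhs => rw [h.eq]
    simp only [Matrix.mul_assoc]
  rw [this, MaxCorr.trace_conjTranspose_mul, wsq, Fintype.sum_prod_type, Complex.re_sum]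
  refine Finset.sum_congr rfl fun i _ => ?_
  rw [Complex.re_sum]
  refine Finset.sum_congr rfl fun j _ => ?_
  rw [Matrix.mul_diagonal, ← mul_assoc, Complex.star_def, Complex.conj_mul', mul_comm]
  norm_cast

/-- The norm for `k = 1` in an eigenbasis. -/
lemma Diagonalizes.trace_mul_conjTranspose_mul (h : Diagonalizes U d σ) (X : Matrix ι ι ℂ) :
    (X * Xᴴ * σ).trace.re =
      wsq (fun p : κ × κ => d p.1) (fun p => (Uᴴ * X * U) p.1 p.2) := by
  have h1 := h.trace_conjTranspose_mul_mul Xᴴ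
  rw [Matrix.conjTranspose_conjTranspose] at h1
  rw [h1, wsq, wsq, ← (Equiv.prodComm κ κ).sum_comp]
  refine Finset.sum_congr rfl fun p _ => ?_
  have : (Uᴴ * Xᴴ * U) p.2 p.1 = star ((Uᴴ * X * U) p.1 p.2) := by
    rw [← Matrix.conjTranspose_apply, Matrix.conjTranspose_mul, Matrix.conjTranspose_mul,
      Matrix.conjTranspose_conjTranspose, Matrix.mul_assoc]
  simp only [Equiv.prodComm_apply, Prod.fst_swap, Prod.snd_swap, this, norm_star]

lemma Diagonalizes.conj_conj (h : Diagonalizes U d σ) (M : Matrix κ κ ℂ) :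
    Uᴴ * (U * M * Uᴴ) * U = M := by
  rw [show Uᴴ * (U * M * Uᴴ) * U = (Uᴴ * U) * M * (Uᴴ * U) by simp only [Matrix.mul_assoc],
    h.left, Matrix.one_mul, Matrix.mul_one]

end

section

variable {A B : Type*} [Fintype A] [DecidableEq A] [Fintype B] [DecidableEq B]
  {ρ : Matrix (A × B) (A × B) ℂ} {k : ℝ}

/-- The matrix of the correlation form in given bases of `A` and `B`. -/
def corrMatrix {κ κ' : Type*} (U : Matrix A κ ℂ) (V : Matrix B κ' ℂ)
    (ρ : Matrix (A × B) (A × B) ℂ) : Matrix (κ × κ) (κ' × κ') ℂ :=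
  Matrix.of fun p q => ((U ⊗ₖ V)ᴴ * ρ * (U ⊗ₖ V)) (p.2, q.1) (p.1, q.2)

lemma trace_kronecker_eq_corrMatrix {κ κ' : Type*} [Fintype κ] [DecidableEq κ] [Fintype κ']
    [DecidableEq κ'] {U : Matrix A κ ℂ} {V : Matrix B κ' ℂ} (hU : U * Uᴴ = 1) (hV : V * Vᴴ = 1)
    (X : Matrix A A ℂ) (Y : Matrix B B ℂ) :
    ((X ⊗ₖ Yᴴ) * ρ).trace = (fun p : κ × κ => (Uᴴ * X * U) p.1 p.2) ⬝ᵥ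
      corrMatrix U V ρ *ᵥ (fun q : κ' × κ' => star ((Vᴴ * Y * V) q.1 q.2)) := by
  have hW : (U ⊗ₖ V) * (U ⊗ₖ V)ᴴ = 1 := by
    rw [Matrix.conjTranspose_kronecker, ← Matrix.mul_kronecker_mul, hU, hV,
      Matrix.one_kronecker_one]
  have h1 : ((X ⊗ₖ Yᴴ) * ρ).trace = (((Uᴴ * X * U) ⊗ₖ (Vᴴ * Y * V)ᴴ) *
      ((U ⊗ₖ V)ᴴ * ρ * (U ⊗ₖ V))).trace := by
    have : (Uᴴ * X * U) ⊗ₖ (Vᴴ * Y * V)ᴴ = (U ⊗ₖ V)ᴴ * (X ⊗ₖ Yᴴ) * (U ⊗ₖ V) := by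
      rw [Matrix.conjTranspose_kronecker, ← Matrix.mul_kronecker_mul, ← Matrix.mul_kronecker_mul,
        Matrix.conjTranspose_mul, Matrix.conjTranspose_mul, Matrix.conjTranspose_conjTranspose,
        Matrix.mul_assoc Vᴴ]
    rw [this]
    generalize U ⊗ₖ V = W at hW
    rw [show Wᴴ * (X ⊗ₖ Yᴴ) * W * (Wᴴ * ρ * W) = Wᴴ * (X ⊗ₖ Yᴴ * (W * Wᴴ) * ρ * W) by
      simp only [Matrix.mul_assoc], hW, Matrix.mul_one, Matrix.trace_mul_comm Wᴴ,
      Matrix.mul_assoc, hW, Matrix.mul_one]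
  rw [h1, trace_kronecker_mul, dotProduct]
  refine Finset.sum_congr rfl fun p _ => ?_
  rw [Matrix.mulVec, dotProduct, Finset.mul_sum, ← (Equiv.prodComm κ' κ').sum_comp]
  refine Finset.sum_congr rfl fun q _ => ?_
  simp only [corrMatrix, Matrix.of_apply, Equiv.prodComm_apply, Prod.fst_swap, Prod.snd_swap,
    Matrix.conjTranspose_apply (Vᴴ * Y * V)]
  ring

lemma wsq_star {I : Type*} [Fintype I] (w : I → ℝ) (x : I → ℂ) :
    wsq w (fun i => star (x i)) = wsq w x := by
  simp [wsq]

lemma exists_conj_eq {ι κ : Type*} [Fintype ι] [DecidableEq ι] [Fintype κ] [DecidableEq κ]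
    {U : Matrix ι κ ℂ} {d : κ → ℝ} {σ : Matrix ι ι ℂ} (h : Diagonalizes U d σ) (x : κ × κ → ℂ) :
    ∃ X : Matrix ι ι ℂ, (fun p : κ × κ => (Uᴴ * X * U) p.1 p.2) = x :=
  ⟨U * (Matrix.of fun i j => x (i, j)) * Uᴴ, by rw [h.conj_conj]; rfl⟩

/-- A bound for the correlation form in terms of forms that are diagonal in eigenbases amounts
to a weighted bound for its matrix. -/
lemma wBound_corrMatrix_iff {κ κ' : Type*} [Fintype κ] [DecidableEq κ] [Fintype κ']
    [DecidableEq κ'] {U : Matrix A κ ℂ} {V : Matrix B κ' ℂ} {d : κ → ℝ} {e : κ' → ℝ}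
    {σ : Matrix A A ℂ} {τ : Matrix B B ℂ} (hU : Diagonalizes U d σ) (hV : Diagonalizes V e τ)
    (w : κ × κ → ℝ) (v : κ' × κ' → ℝ) (c : ℝ) :
    WBound (corrMatrix U V ρ) w v c ↔ ∀ (X : Matrix A A ℂ) (Y : Matrix B B ℂ),
      ‖((X ⊗ₖ Yᴴ) * ρ).trace‖ ^ 2 ≤ c ^ 2 *
        (wsq w (fun p : κ × κ => (Uᴴ * X * U) p.1 p.2) *
          wsq v (fun q : κ' × κ' => (Vᴴ * Y * V) q.1 q.2)) := by
  constructor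
  · intro h X Y
    rw [trace_kronecker_eq_corrMatrix hU.right hV.right, ← wsq_star v]
    exact h _ _
  · intro h x y
    obtain ⟨X, rfl⟩ := exists_conj_eq hU x
    obtain ⟨Y, hY⟩ := exists_conj_eq hV (fun q => star (y q))
    have hy : (fun q : κ' × κ' => star ((Vᴴ * Y * V) q.1 q.2)) = y := by
      funext q
      rw [congrFun hY q, star_star]
    have := h X Y
    rwa [trace_kronecker_eq_corrMatrix hU.right hV.right, ← wsq_star v, hy] at this

/-- The correlation form is a contraction: `|Tr[(X ⊗ Y*) ρ]|² ≤ ⟨X, X⟩ ⟨Y, Y⟩`. The cases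
`k = 0` and `k = 1` are instances of the Cauchy–Schwarz inequality, between which one
interpolates. -/
theorem norm_trace_kronecker_sq_le_normSqJ (hρ : ρ.PosSemidef) (hk : k ∈ Set.Icc (0 : ℝ) 1)
    (X : Matrix A A ℂ) (Y : Matrix B B ℂ) :
    ‖((X ⊗ₖ Yᴴ) * ρ).trace‖ ^ 2 ≤
      normSqJ k (marginalA ρ) X * normSqJ k (marginalB ρ) Y := by
  have hA := posSemidef_marginalA hρ
  have hB := posSemidef_marginalB hρ
  have hU := diagonalizes_eigenvectorUnitary hA.isHermitian
  have hV := diagonalizes_eigenvectorUnitary hB.isHermitian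
  rw [hU.normSqJ_eq hA hk, hV.normSqJ_eq hB hk]
  have h0 := (wBound_corrMatrix_iff (ρ := ρ) hU hV (fun p => hA.isHermitian.eigenvalues p.2)
    (fun q => hB.isHermitian.eigenvalues q.2) 1).2 fun X Y => by
      rw [← hU.trace_conjTranspose_mul_mul, ← hV.trace_conjTranspose_mul_mul, one_pow, one_mul]
      exact norm_trace_kronecker_sq_le hρ X Y
  have h1 := (wBound_corrMatrix_iff (ρ := ρ) hU hV (fun p => hA.isHermitian.eigenvalues p.1)
    (fun q => hB.isHermitian.eigenvalues q.1) 1).2 fun X Y => by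
      rw [← hU.trace_mul_conjTranspose_mul, ← hV.trace_mul_conjTranspose_mul, one_pow, one_mul]
      exact norm_trace_kronecker_sq_le' hρ X Y
  have := (wBound_corrMatrix_iff hU hV _ _ _).1 (h0.interpolate (fun p => hU.nonneg hA _)
    (fun p => hU.nonneg hA _) (fun p => hV.nonneg hB _) (fun p => hV.nonneg hB _) h1 hk) X Y
  rwa [one_pow, one_mul] at this

/-! ### The maximal correlation as a best constant -/

/-- The centred correlation form `Tr[(X ⊗ Y*) ρ] - ⟨1, X⟩ ⟨Y, 1⟩` has norm at most `c`. -/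
def CorrBound (k : ℝ) (ρ : Matrix (A × B) (A × B) ℂ) (c : ℝ) : Prop :=
  ∀ (X : Matrix A A ℂ) (Y : Matrix B B ℂ),
    ‖((X ⊗ₖ Yᴴ) * ρ).trace - (X * marginalA ρ).trace * (Yᴴ * marginalB ρ).trace‖ ^ 2 ≤
      c ^ 2 * (normSqJ k (marginalA ρ) X * normSqJ k (marginalB ρ) Y)

lemma trace_sub_smul_one_kronecker (hρ : IsState ρ) (X : Matrix A A ℂ) (Y : Matrix B B ℂ) :
    (((X - (X * marginalA ρ).trace • 1) ⊗ₖ (Y - (Y * marginalB ρ).trace • 1)) * ρ).trace =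
      ((X ⊗ₖ Y) * ρ).trace - (X * marginalA ρ).trace * (Y * marginalB ρ).trace := by
  have h1 : ((1 : Matrix A A ℂ) ⊗ₖ (1 : Matrix B B ℂ) * ρ).trace = 1 := by
    rw [Matrix.one_kronecker_one, Matrix.one_mul, hρ.2]
  have hX := trace_mul_marginalA X ρ
  have hY := trace_mul_marginalB Y ρ
  set a := (X * marginalA ρ).trace
  set b := (Y * marginalB ρ).trace
  simp only [sub_eq_add_neg, ← neg_smul, Matrix.add_kronecker, Matrix.kronecker_add,
    Matrix.smul_kronecker, Matrix.kronecker_smul, Matrix.add_mul, Matrix.smul_mul,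
    Matrix.trace_add, Matrix.trace_smul, h1, ← hX, ← hY, smul_eq_mul]
  ring

theorem muLin_le_iff (hρ : IsState ρ) (hk : k ∈ Set.Icc (0 : ℝ) 1) {c : ℝ} (hc : 0 ≤ c) :
    muLin (powerFun k) ρ ≤ ENNReal.ofReal c ↔ CorrBound k ρ c := by
  have hA := hρ.marginalA
  have hB := hρ.marginalB
  constructor
  · intro h X Y
    set X' := X - innerJ (powerFun k) (marginalA ρ) 1 X • 1 with hX'
    set Y' := Y - innerJ (powerFun k) (marginalB ρ) 1 Y • 1 with hY'
    have nX : normSqJ k (marginalA ρ) X' ≤ normSqJ k (marginalA ρ) X := by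
      rw [hX', normSqJ_sub_smul_one hA.1 hA.2 hk]
      exact sub_le_self _ (by positivity)
    have nY : normSqJ k (marginalB ρ) Y' ≤ normSqJ k (marginalB ρ) Y := by
      rw [hY', normSqJ_sub_smul_one hB.1 hB.2 hk]
      exact sub_le_self _ (by positivity)
    have oX : innerJ (powerFun k) (marginalA ρ) 1 X' = 0 :=
      innerJ_one_sub_smul_one hA.1 hA.2 hk X
    have oY : innerJ (powerFun k) (marginalB ρ) 1 Y' = 0 :=
      innerJ_one_sub_smul_one hB.1 hB.2 hk Y
    have pX := normSqJ_nonneg hA.1 hk X'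
    have pY := normSqJ_nonneg hB.1 hk Y'
    have hYs : Y'ᴴ = Yᴴ - (Yᴴ * marginalB ρ).trace • 1 := by
      rw [hY', innerJ_one_left hB.1 hk, Matrix.conjTranspose_sub, Matrix.conjTranspose_smul,
        Matrix.conjTranspose_one, ← Matrix.trace_conjTranspose, Matrix.conjTranspose_mul,
        hB.1.isHermitian.eq, Matrix.trace_mul_comm]
    have hval : ((X' ⊗ₖ Y'ᴴ) * ρ).trace = ((X ⊗ₖ Yᴴ) * ρ).trace -
        (X * marginalA ρ).trace * (Yᴴ * marginalB ρ).trace := by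
      rw [← trace_sub_smul_one_kronecker hρ, hYs, hX', innerJ_one_left hA.1 hk]
    rw [← hval]
    refine le_trans ?_ (mul_le_mul_of_nonneg_left
      (mul_le_mul nX nY pY (pX.trans nX)) (sq_nonneg c))
    have hcs := norm_trace_kronecker_sq_le_normSqJ hρ.1 hk X' Y'
    -- A centred operator of norm zero cannot be normalised, but its correlations vanish.
    rcases pX.eq_or_lt with h0 | hX0
    · rw [← h0, zero_mul] at hcs ⊢
      simpa using hcs
    rcases pY.eq_or_lt with h0 | hY0
    · rw [← h0, mul_zero] at hcs ⊢
      simpa using hcs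
    -- Both norms are positive, so the pair can be normalised.
    set a := (√(normSqJ k (marginalA ρ) X'))⁻¹ with ha
    set b := (√(normSqJ k (marginalB ρ) Y'))⁻¹ with hb
    have ha2 : a ^ 2 * normSqJ k (marginalA ρ) X' = 1 := by
      rw [ha, inv_pow, Real.sq_sqrt pX, inv_mul_cancel₀ hX0.ne']
    have hb2 : b ^ 2 * normSqJ k (marginalB ρ) Y' = 1 := by
      rw [hb, inv_pow, Real.sq_sqrt pY, inv_mul_cancel₀ hY0.ne']
    have uX : innerJ (powerFun k) (marginalA ρ) ((a : ℂ) • X') ((a : ℂ) • X') = 1 := by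
      rw [innerJ_smul_left, innerJ_smul_right, innerJ_self hA.1 hk, ← mul_assoc, Complex.star_def,
        Complex.conj_ofReal, ← sq]
      exact_mod_cast ha2
    have uY : innerJ (powerFun k) (marginalB ρ) ((b : ℂ) • Y') ((b : ℂ) • Y') = 1 := by
      rw [innerJ_smul_left, innerJ_smul_right, innerJ_self hB.1 hk, ← mul_assoc, Complex.star_def,
        Complex.conj_ofReal, ← sq]
      exact_mod_cast hb2
    have hle : ‖((((a : ℂ) • X') ⊗ₖ ((b : ℂ) • Y')ᴴ) * ρ).trace‖ₑ ≤ ENNReal.ofReal c := by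
      refine le_trans ?_ h
      refine le_iSup_of_le ((a : ℂ) • X') (le_iSup_of_le ((b : ℂ) • Y') ?_)
      refine le_iSup_of_le (by rw [innerJ_smul_right, oX, mul_zero])
        (le_iSup_of_le (by rw [innerJ_smul_right, oY, mul_zero]) ?_)
      exact le_iSup_of_le uX (le_iSup_of_le uY le_rfl)
    rw [← ofReal_norm, ENNReal.ofReal_le_ofReal_iff hc, Matrix.conjTranspose_smul,
      Complex.star_def, Complex.conj_ofReal, Matrix.smul_kronecker, Matrix.kronecker_smul,
      Matrix.smul_mul, Matrix.smul_mul, Matrix.trace_smul, Matrix.trace_smul, norm_smul, norm_smul,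
      Complex.norm_real, Complex.norm_real] at hle
    have hsq := pow_le_pow_left₀ (by positivity) hle 2
    simp only [mul_pow, Real.norm_eq_abs, sq_abs] at hsq
    calc _ = a ^ 2 * (b ^ 2 * ‖((X' ⊗ₖ Y'ᴴ) * ρ).trace‖ ^ 2) *
          (normSqJ k (marginalA ρ) X' * normSqJ k (marginalB ρ) Y') := by
          linear_combination (-‖((X' ⊗ₖ Y'ᴴ) * ρ).trace‖ ^ 2) *
            (ha2 * (b ^ 2 * normSqJ k (marginalB ρ) Y') + hb2)
      _ ≤ _ := by gcongr
  · intro h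
    refine iSup_le fun X => iSup_le fun Y => iSup_le fun oX => iSup_le fun _ => iSup_le fun uX =>
      iSup_le fun uY => ?_
    have := h X Y
    rw [innerJ_one_left hA.1 hk] at oX
    rw [normSqJ, normSqJ, uX, uY, oX] at this
    simp only [zero_mul, sub_zero, Complex.one_re, mul_one] at this
    rw [← ofReal_norm]
    exact ENNReal.ofReal_le_ofReal (le_of_sq_le_sq this hc)

lemma muLin_ne_top (hρ : IsState ρ) (hk : k ∈ Set.Icc (0 : ℝ) 1) : muLin (powerFun k) ρ ≠ ⊤ := by
  refine ne_top_of_le_ne_top ENNReal.one_ne_top ?_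
  refine iSup_le fun X => iSup_le fun Y => iSup_le fun _ => iSup_le fun _ => iSup_le fun uX =>
    iSup_le fun uY => ?_
  have := norm_trace_kronecker_sq_le_normSqJ hρ.1 hk X Y
  rw [normSqJ, normSqJ, uX, uY] at this
  rw [← ofReal_norm, ← ENNReal.ofReal_one]
  refine ENNReal.ofReal_le_ofReal ?_
  simpa using this

/-- The maximal correlation is itself a bound for the centred correlation form. -/
lemma corrBound_muLin (hρ : IsState ρ) (hk : k ∈ Set.Icc (0 : ℝ) 1) :
    CorrBound k ρ (muLin (powerFun k) ρ).toReal := by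
  rw [← muLin_le_iff hρ hk ENNReal.toReal_nonneg, ENNReal.ofReal_toReal (muLin_ne_top hρ hk)]

end

/-! ### Data processing under local two-positive maps -/

section

variable {ι κ : Type*} [Fintype ι] [DecidableEq ι] [Fintype κ]

/-- The Heisenberg picture of `ℰ`: the adjoint of `ℰ` for the pairing `(X, M) ↦ Tr[X M]`. -/
def adjMap (ℰ : Matrix ι ι ℂ →ₗ[ℂ] Matrix κ κ ℂ) (X : Matrix κ κ ℂ) : Matrix ι ι ℂ :=
  Matrix.of fun i j => (X * ℰ (Matrix.single j i 1)).trace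

variable {ℰ : Matrix ι ι ℂ →ₗ[ℂ] Matrix κ κ ℂ}

omit [Fintype ι] in
lemma adjMap_add (X Y : Matrix κ κ ℂ) : adjMap ℰ (X + Y) = adjMap ℰ X + adjMap ℰ Y := by
  ext i j
  simp [adjMap, add_mul]

omit [Fintype ι] in
lemma adjMap_smul (c : ℂ) (X : Matrix κ κ ℂ) : adjMap ℰ (c • X) = c • adjMap ℰ X := by
  ext i j
  simp [adjMap]

lemma trace_adjMap_mul (X : Matrix κ κ ℂ) (M : Matrix ι ι ℂ) :
    (adjMap ℰ X * M).trace = (X * ℰ M).trace := by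
  conv_rhs => rw [Matrix.matrix_eq_sum_single M]
  simp only [map_sum, Finset.mul_sum, Matrix.trace_sum]
  rw [Finset.sum_comm]
  simp only [Matrix.trace, Matrix.diag, Matrix.mul_apply (M := adjMap ℰ X)]
  refine Finset.sum_congr rfl fun i _ => Finset.sum_congr rfl fun j _ => ?_
  have : Matrix.single j i (M j i) = M j i • Matrix.single j i (1 : ℂ) := by simp
  rw [this, map_smul, Matrix.mul_smul, mul_comm]
  exact (Matrix.trace_smul (M j i) (X * ℰ (Matrix.single j i 1))).symm

lemma IsTracePreserving.adjMap_one [DecidableEq κ] (h : IsTracePreserving ℰ) :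
    adjMap ℰ 1 = 1 := by
  ext i j
  rw [adjMap, Matrix.of_apply, Matrix.one_mul, h]
  by_cases hij : i = j
  · subst hij; simp
  · rw [Matrix.trace_single_eq_of_ne _ _ _ (Ne.symm hij), Matrix.one_apply_ne hij]

omit [DecidableEq ι] in
/-- Two-positivity applied to `C τ Cᴴ`, where `C` is the column with the blocks `G 0` and `G 1`. -/
lemma IsKPositive.posSemidef_block (h : IsKPositive 2 ℰ) {τ : Matrix ι ι ℂ} (hτ : τ.PosSemidef)
    (G : Fin 2 → Matrix ι ι ℂ) :
    (Matrix.of fun x y : Fin 2 × κ => ℰ (G x.1 * τ * (G y.1)ᴴ) x.2 y.2).PosSemidef := by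
  exact h _ (hτ.mul_mul_conjTranspose_same
    (Matrix.of fun (x : Fin 2 × ι) (b : ι) => G x.1 x.2 b))

lemma IsKPositive.map_posSemidef (h : IsKPositive 2 ℰ) {τ : Matrix ι ι ℂ} (hτ : τ.PosSemidef) :
    (ℰ τ).PosSemidef := by
  have := (h.posSemidef_block hτ (fun _ => 1)).submatrix (fun a : κ => ((0 : Fin 2), a))
  simpa using! this

lemma IsKPositive.map_conjTranspose (h : IsKPositive 2 ℰ) (M : Matrix ι ι ℂ) :
    ℰ Mᴴ = (ℰ M)ᴴ := by
  have := (h.posSemidef_block Matrix.PosSemidef.one ![M, 1]).isHermitian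
  ext a b
  have h1 := congrFun (congrFun this (1, a)) (0, b)
  simp [Matrix.conjTranspose_apply] at h1
  rw [Matrix.conjTranspose_apply, ← h1]
  rfl

lemma IsKPositive.adjMap_conjTranspose (h : IsKPositive 2 ℰ) (X : Matrix κ κ ℂ) :
    adjMap ℰ Xᴴ = (adjMap ℰ X)ᴴ := by
  ext i j
  rw [Matrix.conjTranspose_apply, adjMap, adjMap, Matrix.of_apply, Matrix.of_apply,
    ← Matrix.trace_conjTranspose, Matrix.conjTranspose_mul, ← h.map_conjTranspose,
    Matrix.trace_mul_comm, Matrix.conjTranspose_single, star_one]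

/-- The Schwarz inequality for the Heisenberg picture of a two-positive map, tested on `τ`. -/
lemma IsKPositive.schwarz (h : IsKPositive 2 ℰ) (hT : IsTracePreserving ℰ) {τ : Matrix ι ι ℂ}
    (hτ : τ.PosSemidef) (X : Matrix κ κ ℂ) :
    ((adjMap ℰ X)ᴴ * adjMap ℰ X * τ).trace.re ≤ (Xᴴ * X * ℰ τ).trace.re := by
  classical
  set Z := adjMap ℰ X with hZ
  -- The blocks are chosen such that the resulting inequality reads
  -- `Tr[Zᴴ Z τ] - 2 Tr[Zᴴ Z τ] + Tr[Xᴴ X ℰ τ] ≥ 0`.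
  have h1 := h.posSemidef_block hτ ![Z, -1]
  set H : Fin 2 → Matrix κ κ ℂ := ![1, Xᴴ] with hH
  have h2 := (h1.conjTranspose_mul_mul_same
    (Matrix.of fun (x : Fin 2 × κ) (b : κ) => H x.1 x.2 b)).trace_nonneg
  have h3 : ((Matrix.of fun (x : Fin 2 × κ) (b : κ) => H x.1 x.2 b)ᴴ *
      (Matrix.of fun x y : Fin 2 × κ =>
        ℰ ((![Z, -1] : Fin 2 → Matrix ι ι ℂ) x.1 * τ * ((![Z, -1] : Fin 2 → Matrix ι ι ℂ) y.1)ᴴ)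
          x.2 y.2) *
      (Matrix.of fun (x : Fin 2 × κ) (b : κ) => H x.1 x.2 b)) =
      ∑ y, ∑ x, (H x)ᴴ *
        ℰ ((![Z, -1] : Fin 2 → Matrix ι ι ℂ) x * τ * ((![Z, -1] : Fin 2 → Matrix ι ι ℂ) y)ᴴ) *
          H y := by
    ext a b
    simp only [Matrix.mul_apply, Matrix.sum_apply, Fintype.sum_prod_type, Matrix.of_apply,
      Matrix.conjTranspose_apply, Finset.sum_mul]
    refine Finset.sum_congr rfl fun y _ => ?_
    rw [Finset.sum_comm]
  rw [h3] at h2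
  simp only [Fin.sum_univ_two, hH, Matrix.cons_val_zero, Matrix.cons_val_one,
    Matrix.conjTranspose_one, Matrix.conjTranspose_neg, Matrix.one_mul, Matrix.mul_one,
    Matrix.conjTranspose_conjTranspose, neg_mul, mul_neg, neg_neg, map_neg, Matrix.trace_add,
    Matrix.trace_neg] at h2
  have t1 : (ℰ (Z * τ * Zᴴ)).trace = (Zᴴ * Z * τ).trace := by
    rw [hT, Matrix.trace_mul_comm, Matrix.mul_assoc]
  have t2 : (X * ℰ (τ * Zᴴ)).trace = (Zᴴ * Z * τ).trace := by
    rw [← trace_adjMap_mul, ← hZ, ← Matrix.mul_assoc, Matrix.trace_mul_comm, Matrix.mul_assoc]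
  have t3 : (ℰ (Z * τ) * Xᴴ).trace = (Zᴴ * Z * τ).trace := by
    rw [Matrix.trace_mul_comm, ← trace_adjMap_mul, h.adjMap_conjTranspose, ← hZ, Matrix.mul_assoc]
  have t4 : (X * ℰ τ * Xᴴ).trace = (Xᴴ * X * ℰ τ).trace := by
    rw [Matrix.trace_mul_comm, Matrix.mul_assoc]
  rw [t1, t2, t3, t4] at h2
  have h5 := (Complex.le_def.1 h2).1
  simp only [Complex.zero_re, Complex.add_re, Complex.neg_re] at h5
  linarith

/-- The same inequality for the opposite order of multiplication. -/
lemma IsKPositive.schwarz' (h : IsKPositive 2 ℰ) (hT : IsTracePreserving ℰ) {τ : Matrix ι ι ℂ}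
    (hτ : τ.PosSemidef) (X : Matrix κ κ ℂ) :
    (adjMap ℰ X * (adjMap ℰ X)ᴴ * τ).trace.re ≤ (X * Xᴴ * ℰ τ).trace.re := by
  have := h.schwarz hT hτ Xᴴ
  rwa [h.adjMap_conjTranspose, Matrix.conjTranspose_conjTranspose,
    Matrix.conjTranspose_conjTranspose] at this

/-- The Heisenberg picture of a two-positive trace-preserving map contracts the norms of the
power functions. For `k = 0` and `k = 1` this is the Schwarz inequality, between which one
interpolates. -/
theorem normSqJ_adjMap_le [DecidableEq κ] (h : IsKPositive 2 ℰ) (hT : IsTracePreserving ℰ)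
    {τ : Matrix ι ι ℂ} (hτ : τ.PosSemidef) {k : ℝ} (hk : k ∈ Set.Icc (0 : ℝ) 1)
    (X : Matrix κ κ ℂ) : normSqJ k τ (adjMap ℰ X) ≤ normSqJ k (ℰ τ) X := by
  have hσ := h.map_posSemidef hτ
  have hU := diagonalizes_eigenvectorUnitary hτ.isHermitian
  have hV := diagonalizes_eigenvectorUnitary hσ.isHermitian
  rw [hU.normSqJ_eq hτ hk, hV.normSqJ_eq hσ hk]
  generalize hτ.isHermitian.eigenvalues = d at hU ⊢
  generalize hσ.isHermitian.eigenvalues = e at hV ⊢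
  generalize (hτ.isHermitian.eigenvectorUnitary : Matrix ι ι ℂ) = U at hU ⊢
  generalize (hσ.isHermitian.eigenvectorUnitary : Matrix κ κ ℂ) = V at hV ⊢
  let L : (κ × κ → ℂ) →ₗ[ℂ] (ι × ι → ℂ) :=
    { toFun := fun x p => (Uᴴ * adjMap ℰ (V * Matrix.of (Function.curry x) * Vᴴ) * U) p.1 p.2
      map_add' := by
        intro x y
        funext p
        change (Uᴴ * adjMap ℰ (V * (Matrix.of (Function.curry x) + Matrix.of (Function.curry y)) *
          Vᴴ) * U) p.1 p.2 = _
        rw [Matrix.mul_add, Matrix.add_mul, adjMap_add, Matrix.mul_add, Matrix.add_mul]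
        rfl
      map_smul' := by
        intro c x
        funext p
        change (Uᴴ * adjMap ℰ (V * (c • Matrix.of (Function.curry x)) * Vᴴ) * U) p.1 p.2 = _
        rw [Matrix.mul_smul, Matrix.smul_mul, adjMap_smul, Matrix.mul_smul, Matrix.smul_mul]
        rfl }
  have hL : ∀ X : Matrix κ κ ℂ, LinearMap.toMatrix' L *ᵥ
      (fun q : κ × κ => (Vᴴ * X * V) q.1 q.2) =
      fun p : ι × ι => (Uᴴ * adjMap ℰ X * U) p.1 p.2 := by
    intro X
    rw [LinearMap.toMatrix'_mulVec]
    have : V * (Matrix.of fun i j => (Vᴴ * X * V) i j) * Vᴴ = X := by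
      rw [show (Matrix.of fun i j => (Vᴴ * X * V) i j) = Vᴴ * X * V from rfl,
        show V * (Vᴴ * X * V) * Vᴴ = (V * Vᴴ) * X * (V * Vᴴ) by simp only [Matrix.mul_assoc],
        hV.right, Matrix.one_mul, Matrix.mul_one]
    ext p
    change (Uᴴ * adjMap ℰ (V * (Matrix.of fun i j => (Vᴴ * X * V) i j) * Vᴴ) * U) p.1 p.2 = _
    rw [this]
  rw [← hL]
  refine wsq_mulVec_interpolate (p0 := fun q : κ × κ => e q.2)
    (p1 := fun q : κ × κ => e q.1) (q0 := fun p : ι × ι => d p.2) (q1 := fun p : ι × ι => d p.1)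
    (fun _ => hV.nonneg hσ _)
    (fun _ => hV.nonneg hσ _) (fun _ => hU.nonneg hτ _) (fun _ => hU.nonneg hτ _) ?_ ?_ hk _
  · intro x
    obtain ⟨X, rfl⟩ := exists_conj_eq hV x
    rw [hL, ← hU.trace_conjTranspose_mul_mul, ← hV.trace_conjTranspose_mul_mul]
    exact h.schwarz hT hτ X
  · intro x
    obtain ⟨X, rfl⟩ := exists_conj_eq hV x
    rw [hL, ← hU.trace_mul_conjTranspose_mul, ← hV.trace_mul_conjTranspose_mul]
    exact h.schwarz' hT hτ X

end

section

variable {A B A' B' : Type*} [Fintype A] [DecidableEq A] [Fintype B] [DecidableEq B]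
  [Fintype A'] [DecidableEq A'] [Fintype B'] [DecidableEq B']
  {ℰ : Matrix A A ℂ →ₗ[ℂ] Matrix A' A' ℂ} {ℱ : Matrix B B ℂ →ₗ[ℂ] Matrix B' B' ℂ}

omit [DecidableEq A'] [DecidableEq B'] in
lemma trace_kronecker_mul_tensorMap (X : Matrix A' A' ℂ) (Y : Matrix B' B' ℂ)
    (M : Matrix (A × B) (A × B) ℂ) :
    ((X ⊗ₖ Y) * tensorMap ℰ ℱ M).trace = ((adjMap ℰ X ⊗ₖ adjMap ℱ Y) * M).trace := by
  simp only [tensorMap, Finset.mul_sum, Matrix.trace_sum, Matrix.mul_smul, Matrix.trace_smul,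
    ← Matrix.mul_kronecker_mul, Matrix.trace_kronecker]
  rw [Finset.sum_comm]
  conv_rhs => simp only [Matrix.trace, Matrix.diag, Matrix.mul_apply]
  refine Finset.sum_congr rfl fun y _ => Finset.sum_congr rfl fun x _ => ?_
  rw [Matrix.kronecker_apply, adjMap, adjMap, Matrix.of_apply, Matrix.of_apply, smul_eq_mul,
    mul_comm]

omit [DecidableEq A'] in
lemma marginalA_tensorMap (hF : IsTracePreserving ℱ) (M : Matrix (A × B) (A × B) ℂ) :
    marginalA (tensorMap ℰ ℱ M) = ℰ (marginalA M) := by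
  refine Matrix.ext_iff_trace_mul_left.2 fun X => ?_
  rw [trace_mul_marginalA, trace_kronecker_mul_tensorMap, hF.adjMap_one, ← trace_mul_marginalA,
    trace_adjMap_mul]

omit [DecidableEq B'] in
lemma marginalB_tensorMap (hE : IsTracePreserving ℰ) (M : Matrix (A × B) (A × B) ℂ) :
    marginalB (tensorMap ℰ ℱ M) = ℱ (marginalB M) := by
  refine Matrix.ext_iff_trace_mul_left.2 fun Y => ?_
  rw [trace_mul_marginalB, trace_kronecker_mul_tensorMap, hE.adjMap_one, ← trace_mul_marginalB,
    trace_adjMap_mul]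

/-- The data processing inequality. -/
theorem muLin_tensorMap_le (hE : IsKPositive 2 ℰ) (hE' : IsTracePreserving ℰ)
    (hF : IsKPositive 2 ℱ) (hF' : IsTracePreserving ℱ) {τ : Matrix (A × B) (A × B) ℂ}
    (hτ : IsState τ) (hσ : IsState (tensorMap ℰ ℱ τ)) {k : ℝ} (hk : k ∈ Set.Icc (0 : ℝ) 1) :
    muLin (powerFun k) (tensorMap ℰ ℱ τ) ≤ muLin (powerFun k) τ := by
  rw [← ENNReal.ofReal_toReal (muLin_ne_top hτ hk), muLin_le_iff hσ hk ENNReal.toReal_nonneg]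
  intro X Y
  have hc := corrBound_muLin hτ hk (adjMap ℰ X) (adjMap ℱ Y)
  rw [marginalA_tensorMap hF', marginalB_tensorMap hE', trace_kronecker_mul_tensorMap,
    ← trace_adjMap_mul, ← trace_adjMap_mul, hF.adjMap_conjTranspose]
  have hA := hτ.marginalA.1
  have hB := hτ.marginalB.1
  refine hc.trans (mul_le_mul_of_nonneg_left ?_ (sq_nonneg _))
  exact mul_le_mul (normSqJ_adjMap_le hE hE' hA hk X) (normSqJ_adjMap_le hF hF' hB hk Y)
    (normSqJ_nonneg hB hk _) (normSqJ_nonneg (hE.map_posSemidef hA) hk _)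

end

/-! ### Contractions and tensor products of centred forms -/

section

variable {I J I' J' : Type*} [Fintype I] [Fintype J] [Fintype I'] [Fintype J']

lemma star_dotProduct_self (x : I → ℂ) : star x ⬝ᵥ x = (wsq (fun _ => 1) x : ℝ) := by
  rw [dotProduct, wsq, Complex.ofReal_sum]
  refine Finset.sum_congr rfl fun i _ => ?_
  rw [Pi.star_apply, Complex.star_def, Complex.conj_mul']
  push_cast
  ring

/-- Norm bounds as operator inequalities. -/
lemma posSemidef_sq_sub_iff [DecidableEq J] (K : Matrix I J ℂ) (c : ℝ) :
    (((c ^ 2 : ℝ) : ℂ) • (1 : Matrix J J ℂ) - Kᴴ * K).PosSemidef ↔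
      ∀ y, wsq (fun _ => 1) (K *ᵥ y) ≤ c ^ 2 * wsq (fun _ => 1) y := by
  have hval : ∀ y : J → ℂ, star y ⬝ᵥ (((c ^ 2 : ℝ) : ℂ) • (1 : Matrix J J ℂ) - Kᴴ * K) *ᵥ y =
      ((c ^ 2 * wsq (fun _ => 1) y - wsq (fun _ => 1) (K *ᵥ y) : ℝ) : ℂ) := by
    intro y
    rw [Matrix.sub_mulVec, dotProduct_sub, Matrix.smul_mulVec, Matrix.one_mulVec, dotProduct_smul,
      star_dotProduct_self, ← Matrix.mulVec_mulVec, Matrix.dotProduct_mulVec,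
      ← Matrix.star_mulVec, star_dotProduct_self, smul_eq_mul]
    push_cast
    ring
  rw [Matrix.posSemidef_iff_dotProduct_mulVec]
  constructor
  · rintro ⟨-, h⟩ y
    have := h y
    rw [hval, Complex.zero_le_real] at this
    linarith
  · intro h
    refine ⟨?_, fun y => ?_⟩
    · refine Matrix.IsHermitian.sub ?_ (Matrix.isHermitian_conjTranspose_mul_self K)
      rw [Matrix.IsHermitian, Matrix.conjTranspose_smul, Matrix.conjTranspose_one,
        Complex.star_def, Complex.conj_ofReal]
    · rw [hval, Complex.zero_le_real]
      linarith [h y]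

/-- The matrix of a form in coordinates for which the weights become one. Since `0⁻¹ = 0`, the
rows and columns of weight zero become zero. -/
def normMat (w : I → ℝ) (v : J → ℝ) (T : Matrix I J ℂ) : Matrix I J ℂ :=
  Matrix.of fun p q => ((√(w p))⁻¹ : ℝ) * T p q * ((√(v q))⁻¹ : ℝ)

lemma wsq_inv_sqrt_le {w : I → ℝ} (hw : ∀ i, 0 ≤ w i) (x : I → ℂ) :
    wsq w (fun i => ((√(w i))⁻¹ : ℝ) * x i) ≤ wsq (fun _ => 1) x := by
  refine Finset.sum_le_sum fun i _ => ?_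
  rw [norm_mul, Complex.norm_real, mul_pow, Real.norm_eq_abs, sq_abs, inv_pow, Real.sq_sqrt (hw i),
    ← mul_assoc]
  gcongr
  exact mul_inv_le_one

lemma WBound.posSemidef [DecidableEq J] {w : I → ℝ} {v : J → ℝ} (hw : ∀ i, 0 ≤ w i)
    (hv : ∀ j, 0 ≤ v j) {T : Matrix I J ℂ} {c : ℝ} (h : WBound T w v c) :
    (((c ^ 2 : ℝ) : ℂ) • (1 : Matrix J J ℂ) - (normMat w v T)ᴴ * normMat w v T).PosSemidef := by
  rw [posSemidef_sq_sub_iff]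
  intro y
  set z := normMat w v T *ᵥ y with hz
  -- The form is tested on the vector dual to `z`.
  have h1 := h (fun i => ((√(w i))⁻¹ : ℝ) * star (z i)) (fun j => ((√(v j))⁻¹ : ℝ) * y j)
  have h2 : (fun i => (((√(w i))⁻¹ : ℝ) : ℂ) * star (z i)) ⬝ᵥ
      T *ᵥ (fun j => (((√(v j))⁻¹ : ℝ) : ℂ) * y j) = (wsq (fun _ => 1) z : ℝ) := by
    rw [← star_dotProduct_self]
    refine Finset.sum_congr rfl fun i _ => ?_
    rw [mul_right_comm, mul_comm (_ * _) (star _), Pi.star_apply]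
    congr 1
    simp only [hz, normMat, Matrix.mulVec, dotProduct, Matrix.of_apply, Finset.mul_sum]
    refine Finset.sum_congr rfl fun j _ => ?_
    ring
  have hz0 : 0 ≤ wsq (fun _ => 1) z := wsq_nonneg (fun _ => zero_le_one) z
  have hy0 : 0 ≤ wsq (fun _ => 1) y := wsq_nonneg (fun _ => zero_le_one) y
  have h3 := wsq_inv_sqrt_le hw (fun i => star (z i))
  rw [wsq_star] at h3
  rw [h2, Complex.norm_real, Real.norm_of_nonneg hz0, sq] at h1
  have h4 : wsq (fun _ => 1) z * wsq (fun _ => 1) z ≤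
      wsq (fun _ => 1) z * (c ^ 2 * wsq (fun _ => 1) y) := by
    refine h1.trans ?_
    rw [mul_left_comm]
    gcongr
    · exact mul_nonneg (sq_nonneg c) (wsq_nonneg hv _)
    · exact wsq_inv_sqrt_le hv y
  rcases hz0.eq_or_lt with h0 | h0
  · rw [← h0]
    positivity
  · exact le_of_mul_le_mul_left h4 h0

lemma norm_dotProduct_sq_le (x y : I → ℂ) :
    ‖x ⬝ᵥ y‖ ^ 2 ≤ wsq (fun _ => 1) x * wsq (fun _ => 1) y := by
  calc _ ≤ (∑ i, ‖x i‖ * ‖y i‖) ^ 2 := by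
        gcongr
        refine (norm_sum_le _ _).trans (le_of_eq (Finset.sum_congr rfl fun i _ => norm_mul _ _))
    _ ≤ _ := Finset.sum_mul_sq_le_sq_mul_sq _ _ _
    _ = _ := by simp [wsq]

lemma wsq_sqrt {w : I → ℝ} (hw : ∀ i, 0 ≤ w i) (x : I → ℂ) :
    wsq (fun _ => 1) (fun i => (√(w i) : ℝ) * x i) = wsq w x := by
  refine Finset.sum_congr rfl fun i _ => ?_
  rw [norm_mul, Complex.norm_real, mul_pow, Real.norm_eq_abs, sq_abs, Real.sq_sqrt (hw i), one_mul]

lemma wBound_of_posSemidef [DecidableEq J] {w : I → ℝ} {v : J → ℝ} (hw : ∀ i, 0 ≤ w i)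
    (hv : ∀ j, 0 ≤ v j) {T K : Matrix I J ℂ} {c : ℝ}
    (hT : ∀ p q, T p q = (√(w p) : ℝ) * K p q * (√(v q) : ℝ))
    (h : (((c ^ 2 : ℝ) : ℂ) • (1 : Matrix J J ℂ) - Kᴴ * K).PosSemidef) : WBound T w v c := by
  rw [posSemidef_sq_sub_iff] at h
  intro x y
  have h1 : x ⬝ᵥ T *ᵥ y = (fun i => ((√(w i) : ℝ) : ℂ) * x i) ⬝ᵥ
      K *ᵥ (fun j => ((√(v j) : ℝ) : ℂ) * y j) := by
    simp only [dotProduct, Matrix.mulVec, Finset.mul_sum, hT]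
    refine Finset.sum_congr rfl fun i _ => Finset.sum_congr rfl fun j _ => ?_
    ring
  rw [h1]
  refine (norm_dotProduct_sq_le _ _).trans ?_
  rw [wsq_sqrt hw, mul_left_comm, ← wsq_sqrt hv]
  exact mul_le_mul_of_nonneg_left (h _) (wsq_nonneg hw x)

/-- The tensor product of two contractions that preserve a unit vector, in terms of their parts
`D`, `D'` on the complements: if `R` is the rank-one part of the first contraction, the tensor
product is `D ⊗ K' + R ⊗ D'` up to the product of the rank-one parts, the two terms act between
orthogonal subspaces, and so the norm is the maximum of the norms of `D` and `D'`. -/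
lemma posSemidef_sq_sub_kronecker [DecidableEq J] [DecidableEq J'] {D R : Matrix I J ℂ}
    {P : Matrix J J ℂ} {K' D' : Matrix I' J' ℂ} {c : ℝ} (hRR : Rᴴ * R = P) (hPP : P * P = P)
    (hRD : Rᴴ * D = 0) (hDP : D * P = 0)
    (hK' : ((1 : Matrix J' J' ℂ) - K'ᴴ * K').PosSemidef)
    (hD : (((c ^ 2 : ℝ) : ℂ) • (1 : Matrix J J ℂ) - Dᴴ * D).PosSemidef)
    (hD' : (((c ^ 2 : ℝ) : ℂ) • (1 : Matrix J' J' ℂ) - D'ᴴ * D').PosSemidef) :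
    (((c ^ 2 : ℝ) : ℂ) • (1 : Matrix (J × J') (J × J') ℂ) -
      (D ⊗ₖ K' + R ⊗ₖ D')ᴴ * (D ⊗ₖ K' + R ⊗ₖ D')).PosSemidef := by
  have hDR : Dᴴ * R = 0 := by
    rw [← Matrix.conjTranspose_conjTranspose R, ← Matrix.conjTranspose_mul, hRD,
      Matrix.conjTranspose_zero]
  have hP : P.PosSemidef := hRR ▸ Matrix.posSemidef_conjTranspose_mul_self R
  have hPD : P * Dᴴ = 0 := by
    rw [← hP.isHermitian.eq, ← Matrix.conjTranspose_mul, hDP, Matrix.conjTranspose_zero]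
  have hQ : ((1 - P)ᴴ * (((c ^ 2 : ℝ) : ℂ) • (1 : Matrix J J ℂ) - Dᴴ * D) * (1 - P)) =
      ((c ^ 2 : ℝ) : ℂ) • (1 - P) - Dᴴ * D := by
    have e1 : (1 - P) * Dᴴ = Dᴴ := by rw [Matrix.sub_mul, hPD, Matrix.one_mul, sub_zero]
    have e2 : D * (1 - P) = D := by rw [Matrix.mul_sub, hDP, Matrix.mul_one, sub_zero]
    have e3 : (1 - P) * (1 - P) = 1 - P := by
      rw [Matrix.mul_sub, Matrix.sub_mul, Matrix.one_mul, Matrix.mul_one, Matrix.sub_mul,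
        Matrix.one_mul, hPP, sub_self, sub_zero]
    have e4 : (1 - P)ᴴ = 1 - P := by
      rw [Matrix.conjTranspose_sub, Matrix.conjTranspose_one, hP.isHermitian.eq]
    rw [e4]
    generalize 1 - P = Q at e1 e2 e3
    rw [Matrix.mul_sub, Matrix.sub_mul, Matrix.mul_smul, Matrix.mul_one, Matrix.smul_mul, e3,
      ← Matrix.mul_assoc, e1, Matrix.mul_assoc, e2]
  have h1 := (hD.conjTranspose_mul_mul_same (1 - P)).kronecker
    (Matrix.PosSemidef.one (n := J') (R := ℂ))
  have h2 := (Matrix.posSemidef_conjTranspose_mul_self D).kronecker hK'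
  have h3 := hP.kronecker hD'
  rw [hQ] at h1
  suffices hsum : ((c ^ 2 : ℝ) : ℂ) • (1 : Matrix (J × J') (J × J') ℂ) -
      (D ⊗ₖ K' + R ⊗ₖ D')ᴴ * (D ⊗ₖ K' + R ⊗ₖ D') =
      (((c ^ 2 : ℝ) : ℂ) • (1 - P) - Dᴴ * D) ⊗ₖ (1 : Matrix J' J' ℂ) +
        (Dᴴ * D) ⊗ₖ (1 - K'ᴴ * K') +
        P ⊗ₖ (((c ^ 2 : ℝ) : ℂ) • (1 : Matrix J' J' ℂ) - D'ᴴ * D') by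
    rw [hsum]
    exact (h1.add h2).add h3
  rw [Matrix.conjTranspose_add, Matrix.add_mul, Matrix.mul_add, Matrix.mul_add,
    Matrix.conjTranspose_kronecker, Matrix.conjTranspose_kronecker, ← Matrix.mul_kronecker_mul,
    ← Matrix.mul_kronecker_mul, ← Matrix.mul_kronecker_mul, ← Matrix.mul_kronecker_mul, hDR, hRD,
    hRR, Matrix.zero_kronecker, Matrix.zero_kronecker, ← Matrix.one_kronecker_one]
  simp only [sub_eq_add_neg, Matrix.add_kronecker, Matrix.kronecker_add, ← neg_one_smul ℂ (_ * _),
    ← neg_one_smul ℂ P, ← neg_one_smul ℂ (_ + _),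
    Matrix.smul_kronecker, Matrix.kronecker_smul, smul_add]
  module

/-- A bilinear form `B` that is a contraction for the weights `w`, `v` and that maps the unit
vectors `e` and `g`, both with real coordinates, to each other. -/
structure CorrData (B : Matrix I J ℂ) (w : I → ℝ) (v : J → ℝ) (e : I → ℂ) (g : J → ℂ) : Prop where
  w_nonneg : ∀ i, 0 ≤ w i
  v_nonneg : ∀ j, 0 ≤ v j
  bound : WBound B w v 1
  star_e : star e = e
  star_g : star g = g
  norm_e : ∑ i, (w i : ℂ) * e i * e i = 1
  norm_g : ∑ j, (v j : ℂ) * g j * g j = 1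
  mulVec_g : B *ᵥ g = fun i => (w i : ℂ) * e i
  vecMul_e : e ᵥ* B = fun j => (v j : ℂ) * g j

/-- The form `B` without its part on the distinguished vectors. -/
def centred (B : Matrix I J ℂ) (w : I → ℝ) (v : J → ℝ) (e : I → ℂ) (g : J → ℂ) : Matrix I J ℂ :=
  B - Matrix.vecMulVec (fun i => (w i : ℂ) * e i) (fun j => (v j : ℂ) * g j)

omit [Fintype I] [Fintype J] in
lemma sqrt_mul_normMat_mul_sqrt {w : I → ℝ} {v : J → ℝ} (hw : ∀ i, 0 ≤ w i)
    (hv : ∀ j, 0 ≤ v j) {T : Matrix I J ℂ} {i : I} {j : J}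
    (h : w i = 0 ∨ v j = 0 → T i j = 0) :
    ((√(w i) : ℝ) : ℂ) * normMat w v T i j * (√(v j) : ℝ) = T i j := by
  by_cases h0 : w i = 0 ∨ v j = 0
  · simp [normMat, h h0]
  · have h1 : ((√(w i) : ℝ) : ℂ) ≠ 0 := by
      exact_mod_cast (Real.sqrt_pos.2 ((hw i).lt_of_ne' fun h => h0 (Or.inl h))).ne'
    have h2 : ((√(v j) : ℝ) : ℂ) ≠ 0 := by
      exact_mod_cast (Real.sqrt_pos.2 ((hv j).lt_of_ne' fun h => h0 (Or.inr h))).ne'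
    simp only [normMat, Matrix.of_apply, Complex.ofReal_inv]
    field_simp

lemma inv_sqrt_mul_self {a : ℝ} (ha : 0 ≤ a) : (((√a)⁻¹ : ℝ) : ℂ) * a = (√a : ℝ) := by
  rw [← Complex.ofReal_mul]
  congr 1
  rcases ha.eq_or_lt with rfl | h
  · simp
  · have := (Real.sqrt_pos.2 h).ne'
    field_simp
    exact (Real.sq_sqrt ha).symm

namespace CorrData

variable {B : Matrix I J ℂ} {w : I → ℝ} {v : J → ℝ} {e : I → ℂ} {g : J → ℂ}
  {B' : Matrix I' J' ℂ} {w' : I' → ℝ} {v' : J' → ℝ} {e' : I' → ℂ} {g' : J' → ℂ}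

lemma normMat_mulVec (h : CorrData B w v e g) :
    normMat w v B *ᵥ (fun j => ((√(v j) : ℝ) : ℂ) * g j) = fun i => ((√(w i) : ℝ) : ℂ) * e i := by
  funext i
  rw [← inv_sqrt_mul_self (h.w_nonneg i), mul_assoc, ← congrFun h.mulVec_g i, Matrix.mulVec,
    Matrix.mulVec, dotProduct, dotProduct, Finset.mul_sum]
  refine Finset.sum_congr rfl fun j _ => ?_
  rw [normMat, Matrix.of_apply]
  by_cases hj : v j = 0
  · simp [h.bound.entry_eq_zero (Or.inr hj)]
  · have h2 : ((√(v j) : ℝ) : ℂ) ≠ 0 := by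
      exact_mod_cast (Real.sqrt_pos.2 ((h.v_nonneg j).lt_of_ne' hj)).ne'
    rw [Complex.ofReal_inv (√(v j))]
    field_simp

lemma vecMul_normMat (h : CorrData B w v e g) :
    (fun i => ((√(w i) : ℝ) : ℂ) * e i) ᵥ* normMat w v B = fun j => ((√(v j) : ℝ) : ℂ) * g j := by
  funext j
  rw [← inv_sqrt_mul_self (h.v_nonneg j), mul_assoc, ← congrFun h.vecMul_e j, Matrix.vecMul,
    Matrix.vecMul, dotProduct, dotProduct, Finset.mul_sum]
  refine Finset.sum_congr rfl fun i _ => ?_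
  rw [normMat, Matrix.of_apply]
  by_cases hi : w i = 0
  · simp [h.bound.entry_eq_zero (Or.inl hi)]
  · have h2 : ((√(w i) : ℝ) : ℂ) ≠ 0 := by
      exact_mod_cast (Real.sqrt_pos.2 ((h.w_nonneg i).lt_of_ne' hi)).ne'
    rw [Complex.ofReal_inv (√(w i))]
    field_simp

lemma centred_eq_zero (h : CorrData B w v e g) {i : I} {j : J} (hij : w i = 0 ∨ v j = 0) :
    centred B w v e g i j = 0 := by
  rw [centred, Matrix.sub_apply, h.bound.entry_eq_zero hij, Matrix.vecMulVec_apply]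
  rcases hij with h | h <;> simp [h]

lemma normMat_centred (h : CorrData B w v e g) :
    normMat w v (centred B w v e g) = normMat w v B -
      Matrix.vecMulVec (fun i => ((√(w i) : ℝ) : ℂ) * e i)
        (fun j => ((√(v j) : ℝ) : ℂ) * g j) := by
  ext i j
  simp only [normMat, centred, Matrix.of_apply, Matrix.sub_apply, Matrix.vecMulVec_apply,
    ← inv_sqrt_mul_self (h.w_nonneg i), ← inv_sqrt_mul_self (h.v_nonneg j)]
  ring

/-- The centred form of a tensor product is bounded by the maximum of the two bounds. -/
theorem wBound_centred_kronecker (h : CorrData B w v e g) (h' : CorrData B' w' v' e' g') {c : ℝ}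
    (hc : WBound (centred B w v e g) w v c) (hc' : WBound (centred B' w' v' e' g') w' v' c) :
    WBound (centred (B ⊗ₖ B') (fun p => w p.1 * w' p.2) (fun q => v q.1 * v' q.2)
      (fun p => e p.1 * e' p.2) (fun q => g q.1 * g' q.2))
      (fun p => w p.1 * w' p.2) (fun q => v q.1 * v' q.2) c := by
  classical
  set u : I → ℂ := fun i => ((√(w i) : ℝ) : ℂ) * e i with hu
  set y : J → ℂ := fun j => ((√(v j) : ℝ) : ℂ) * g j with hy
  have sqrt_sq : ∀ {a : ℝ}, 0 ≤ a → ((√a : ℝ) : ℂ) * (√a : ℝ) = a := by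
    intro a ha
    rw [← Complex.ofReal_mul, Real.mul_self_sqrt ha]
  have su : star u = u := by
    funext i
    have := congrFun h.star_e i
    simp only [Pi.star_apply] at this
    simp [hu, Pi.star_apply, this]
  have sy : star y = y := by
    funext i
    have := congrFun h.star_g i
    simp only [Pi.star_apply] at this
    simp [hy, Pi.star_apply, this]
  have uu : u ⬝ᵥ u = 1 := by
    rw [← h.norm_e]
    refine Finset.sum_congr rfl fun i _ => ?_
    rw [← sqrt_sq (h.w_nonneg i)]
    ring
  have yy : y ⬝ᵥ y = 1 := by
    rw [← h.norm_g]
    refine Finset.sum_congr rfl fun i _ => ?_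
    rw [← sqrt_sq (h.v_nonneg i)]
    ring
  have hKy : normMat w v B *ᵥ y = u := h.normMat_mulVec
  have huK : u ᵥ* normMat w v B = y := h.vecMul_normMat
  have hD : normMat w v (centred B w v e g) = normMat w v B - Matrix.vecMulVec u y :=
    h.normMat_centred
  have hR : (Matrix.vecMulVec u y)ᴴ = Matrix.vecMulVec y u := by
    rw [Matrix.conjTranspose_vecMulVec, su, sy]
  refine wBound_of_posSemidef (K := normMat w v (centred B w v e g) ⊗ₖ normMat w' v' B' +
    Matrix.vecMulVec u y ⊗ₖ normMat w' v' (centred B' w' v' e' g'))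
    (fun p => mul_nonneg (h.w_nonneg _) (h'.w_nonneg _))
    (fun p => mul_nonneg (h.v_nonneg _) (h'.v_nonneg _)) ?_
    (posSemidef_sq_sub_kronecker (P := Matrix.vecMulVec y y) ?_ ?_ ?_ ?_ ?_
      (hc.posSemidef h.w_nonneg h.v_nonneg) (hc'.posSemidef h'.w_nonneg h'.v_nonneg))
  · rintro ⟨i, i'⟩ ⟨j, j'⟩
    have e1 := sqrt_mul_normMat_mul_sqrt h.w_nonneg h.v_nonneg (i := i) (j := j)
      h.centred_eq_zero
    have e2 := sqrt_mul_normMat_mul_sqrt h'.w_nonneg h'.v_nonneg (i := i') (j := j')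
      h'.centred_eq_zero
    have e3 := sqrt_mul_normMat_mul_sqrt h'.w_nonneg h'.v_nonneg (i := i') (j := j')
      (T := B') h'.bound.entry_eq_zero
    rw [Matrix.add_apply, Matrix.kronecker_apply, Matrix.kronecker_apply, Matrix.vecMulVec_apply,
      Real.sqrt_mul (h.w_nonneg i), Real.sqrt_mul (h.v_nonneg j), Complex.ofReal_mul,
      Complex.ofReal_mul]
    have e4 := sqrt_sq (h.w_nonneg i)
    have e5 := sqrt_sq (h.v_nonneg j)
    simp only [hu, hy]
    calc _ = centred B w v e g i j * B' i' j' +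
          (w i * e i) * (v j * g j) * centred B' w' v' e' g' i' j' := by
          simp only [centred, Matrix.sub_apply, Matrix.vecMulVec_apply, Matrix.kronecker_apply,
            Complex.ofReal_mul]
          ring
      _ = _ := by
          rw [← e1, ← e2, ← e4, ← e5]
          conv_lhs => rw [← e3]
          ring
  · rw [hR, Matrix.vecMulVec_mul_vecMulVec, uu, one_smul]
  · rw [Matrix.vecMulVec_mul_vecMulVec, yy, one_smul]
  · rw [hR, hD, Matrix.vecMulVec_mul, Matrix.vecMul_sub, huK, Matrix.vecMul_vecMulVec, uu,
      one_smul, sub_self, Matrix.vecMulVec_zero]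
  · rw [hD, Matrix.mul_vecMulVec, Matrix.sub_mulVec, hKy, Matrix.vecMulVec_mulVec, yy]
    simp
  · simpa using h'.bound.posSemidef h'.w_nonneg h'.v_nonneg

end CorrData

/-- Elementary tensors of vectors. -/
def tensorVec (x : I → ℂ) (x' : I' → ℂ) : I × I' → ℂ := fun p => x p.1 * x' p.2

lemma tensorVec_dotProduct (x y : I → ℂ) (x' y' : I' → ℂ) :
    tensorVec x x' ⬝ᵥ tensorVec y y' = (x ⬝ᵥ y) * (x' ⬝ᵥ y') := by
  rw [dotProduct, dotProduct, dotProduct, Finset.sum_mul_sum, Fintype.sum_prod_type]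
  refine Finset.sum_congr rfl fun i _ => Finset.sum_congr rfl fun j _ => ?_
  simp only [tensorVec]
  ring

omit [Fintype I] [Fintype I'] in
lemma kronecker_mulVec_tensorVec (B : Matrix I J ℂ) (B' : Matrix I' J' ℂ) (y : J → ℂ)
    (y' : J' → ℂ) : (B ⊗ₖ B') *ᵥ tensorVec y y' = tensorVec (B *ᵥ y) (B' *ᵥ y') := by
  funext p
  simp only [Matrix.mulVec, tensorVec, dotProduct]
  rw [Finset.sum_mul_sum, Fintype.sum_prod_type]
  refine Finset.sum_congr rfl fun i _ => Finset.sum_congr rfl fun j _ => ?_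
  rw [Matrix.kronecker_apply]
  ring

lemma wsq_tensorVec (w : I → ℝ) (w' : I' → ℝ) (x : I → ℂ) (x' : I' → ℂ) :
    wsq (fun p : I × I' => w p.1 * w' p.2) (tensorVec x x') = wsq w x * wsq w' x' := by
  rw [wsq, wsq, wsq, Finset.sum_mul_sum, Fintype.sum_prod_type]
  refine Finset.sum_congr rfl fun i _ => Finset.sum_congr rfl fun j _ => ?_
  rw [tensorVec, norm_mul]
  ring

lemma centred_dotProduct (B : Matrix I J ℂ) (w : I → ℝ) (v : J → ℝ) (e : I → ℂ) (g : J → ℂ)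
    (x : I → ℂ) (y : J → ℂ) : x ⬝ᵥ centred B w v e g *ᵥ y =
      x ⬝ᵥ B *ᵥ y - (x ⬝ᵥ fun i => (w i : ℂ) * e i) * ((fun j => (v j : ℂ) * g j) ⬝ᵥ y) := by
  rw [centred, Matrix.sub_mulVec, dotProduct_sub, Matrix.vecMulVec_mulVec]
  simp [mul_comm]

namespace CorrData

variable {B : Matrix I J ℂ} {w : I → ℝ} {v : J → ℝ} {e : I → ℂ} {g : J → ℂ}
  {B' : Matrix I' J' ℂ} {w' : I' → ℝ} {v' : J' → ℝ} {e' : I' → ℂ} {g' : J' → ℂ} {c : ℝ}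

lemma dotProduct_e (h : CorrData B w v e g) : (e ⬝ᵥ fun i => (w i : ℂ) * e i) = 1 := by
  rw [← h.norm_e]
  exact Finset.sum_congr rfl fun i _ => mul_comm _ _

lemma dotProduct_g (h : CorrData B w v e g) : ((fun j => (v j : ℂ) * g j) ⬝ᵥ g) = 1 := h.norm_g

lemma wsq_e (h : CorrData B w v e g) : wsq w e = 1 := by
  have h1 := h.norm_e
  have : ((wsq w e : ℝ) : ℂ) = 1 := by
    rw [← h1, wsq, Complex.ofReal_sum]
    refine Finset.sum_congr rfl fun i _ => ?_
    have := congrFun h.star_e i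
    rw [Complex.ofReal_mul, Complex.ofReal_pow, ← Complex.conj_mul', ← Complex.star_def,
      ← Pi.star_apply, this, mul_assoc]
  exact_mod_cast this

lemma wsq_g (h : CorrData B w v e g) : wsq v g = 1 := by
  have h1 := h.norm_g
  have : ((wsq v g : ℝ) : ℂ) = 1 := by
    rw [← h1, wsq, Complex.ofReal_sum]
    refine Finset.sum_congr rfl fun i _ => ?_
    have := congrFun h.star_g i
    rw [Complex.ofReal_mul, Complex.ofReal_pow, ← Complex.conj_mul', ← Complex.star_def,
      ← Pi.star_apply, this, mul_assoc]
  exact_mod_cast this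

/-- A bound for the tensor product restricts to the first factor, by testing on `x ⊗ e'` and
`y ⊗ g'`. -/
lemma wBound_left (h' : CorrData B' w' v' e' g')
    (hc : WBound (centred (B ⊗ₖ B') (fun p => w p.1 * w' p.2) (fun q => v q.1 * v' q.2)
      (fun p => e p.1 * e' p.2) (fun q => g q.1 * g' q.2))
      (fun p => w p.1 * w' p.2) (fun q => v q.1 * v' q.2) c) :
    WBound (centred B w v e g) w v c := by
  intro x y
  have h1 := hc (tensorVec x e') (tensorVec y g')
  have e1 : (fun p : I × I' => ((w p.1 * w' p.2 : ℝ) : ℂ) * (e p.1 * e' p.2)) =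
      tensorVec (fun i => (w i : ℂ) * e i) (fun i => (w' i : ℂ) * e' i) := by
    funext p; simp only [tensorVec, Complex.ofReal_mul]; ring
  have e2 : (fun p : J × J' => ((v p.1 * v' p.2 : ℝ) : ℂ) * (g p.1 * g' p.2)) =
      tensorVec (fun i => (v i : ℂ) * g i) (fun i => (v' i : ℂ) * g' i) := by
    funext p; simp only [tensorVec, Complex.ofReal_mul]; ring
  rw [centred_dotProduct, e1, e2, kronecker_mulVec_tensorVec, tensorVec_dotProduct,
    tensorVec_dotProduct, tensorVec_dotProduct, h'.mulVec_g, h'.dotProduct_e, h'.dotProduct_g,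
    mul_one, mul_one, mul_one, ← centred_dotProduct, wsq_tensorVec, wsq_tensorVec, h'.wsq_e,
    h'.wsq_g, mul_one, mul_one] at h1
  exact h1

/-- A bound for the tensor product restricts to the second factor, by testing on `e ⊗ x` and
`g ⊗ y`. -/
lemma wBound_right (h : CorrData B w v e g)
    (hc : WBound (centred (B ⊗ₖ B') (fun p => w p.1 * w' p.2) (fun q => v q.1 * v' q.2)
      (fun p => e p.1 * e' p.2) (fun q => g q.1 * g' q.2))
      (fun p => w p.1 * w' p.2) (fun q => v q.1 * v' q.2) c) :
    WBound (centred B' w' v' e' g') w' v' c := by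
  intro x y
  have h1 := hc (tensorVec e x) (tensorVec g y)
  have e1 : (fun p : I × I' => ((w p.1 * w' p.2 : ℝ) : ℂ) * (e p.1 * e' p.2)) =
      tensorVec (fun i => (w i : ℂ) * e i) (fun i => (w' i : ℂ) * e' i) := by
    funext p; simp only [tensorVec, Complex.ofReal_mul]; ring
  have e2 : (fun p : J × J' => ((v p.1 * v' p.2 : ℝ) : ℂ) * (g p.1 * g' p.2)) =
      tensorVec (fun i => (v i : ℂ) * g i) (fun i => (v' i : ℂ) * g' i) := by
    funext p; simp only [tensorVec, Complex.ofReal_mul]; ring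
  rw [centred_dotProduct, e1, e2, kronecker_mulVec_tensorVec, tensorVec_dotProduct,
    tensorVec_dotProduct, tensorVec_dotProduct, h.mulVec_g, h.dotProduct_e, h.dotProduct_g,
    one_mul, one_mul, one_mul, ← centred_dotProduct, wsq_tensorVec, wsq_tensorVec, h.wsq_e,
    h.wsq_g, one_mul, one_mul] at h1
  exact h1

end CorrData

end

/-! ### Tensorization of the maximal correlation -/

/-- The weights of the norm of the `k`-th power function in an eigenbasis. -/
def powerWeight {κ : Type*} (k : ℝ) (d : κ → ℝ) (p : κ × κ) : ℝ := d p.2 ^ (1 - k) * d p.1 ^ k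

/-- The coordinates of the identity matrix. -/
def diagVec (κ : Type*) [DecidableEq κ] (p : κ × κ) : ℂ := (1 : Matrix κ κ ℂ) p.1 p.2

lemma powerWeight_mul {κ κ' : Type*} (k : ℝ) {d : κ → ℝ} {d' : κ' → ℝ} (hd : ∀ i, 0 ≤ d i)
    (hd' : ∀ i, 0 ≤ d' i) : powerWeight k (fun p : κ × κ' => d p.1 * d' p.2) =
      (fun p => powerWeight k d p.1 * powerWeight k d' p.2) ∘
        Equiv.prodProdProdComm κ κ' κ κ' := by
  funext p
  simp only [powerWeight, Function.comp, Equiv.prodProdProdComm_apply]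
  rw [Real.mul_rpow (hd _) (hd' _), Real.mul_rpow (hd _) (hd' _)]
  ring

lemma diagVec_prod (κ κ' : Type*) [DecidableEq κ] [DecidableEq κ'] : diagVec (κ × κ') =
    (fun p => diagVec κ p.1 * diagVec κ' p.2) ∘ Equiv.prodProdProdComm κ κ' κ κ' := by
  funext p
  rw [diagVec, ← Matrix.one_kronecker_one]
  rfl

lemma star_diagVec (κ : Type*) [DecidableEq κ] : star (diagVec κ) = diagVec κ := by
  funext p
  rw [Pi.star_apply, diagVec, Matrix.one_apply]
  split_ifs <;> simp

lemma Diagonalizes.trace_mul_eq {ι κ : Type*} [Fintype ι] [DecidableEq ι] [Fintype κ]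
    [DecidableEq κ] {U : Matrix ι κ ℂ} {d : κ → ℝ} {σ : Matrix ι ι ℂ} (h : Diagonalizes U d σ)
    (hσ : σ.PosSemidef) {k : ℝ} (hk : k ∈ Set.Icc (0 : ℝ) 1) (X : Matrix ι ι ℂ) :
    (X * σ).trace = (fun p : κ × κ => (Uᴴ * X * U) p.1 p.2) ⬝ᵥ
      fun p => (powerWeight k d p : ℂ) * diagVec κ p := by
  rw [← innerJ_one_left hσ hk, h.innerJ_eq, Matrix.mul_one, h.left, dotProduct,
    Fintype.sum_prod_type]
  refine Finset.sum_congr rfl fun i _ => Finset.sum_congr rfl fun j _ => ?_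
  rw [perspective_powerFun hk (h.nonneg hσ i) (h.nonneg hσ j), powerWeight]
  have : star ((1 : Matrix κ κ ℂ) i j) = diagVec κ (i, j) := congrFun (star_diagVec κ) (i, j)
  rw [this]
  ring

lemma Diagonalizes.trace_conjTranspose_mul_eq {ι κ : Type*} [Fintype ι] [DecidableEq ι] [Fintype κ]
    [DecidableEq κ] {U : Matrix ι κ ℂ} {d : κ → ℝ} {σ : Matrix ι ι ℂ} (h : Diagonalizes U d σ)
    (hσ : σ.PosSemidef) {k : ℝ} (hk : k ∈ Set.Icc (0 : ℝ) 1) (X : Matrix ι ι ℂ) :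
    (Xᴴ * σ).trace = (fun p : κ × κ => star ((Uᴴ * X * U) p.1 p.2)) ⬝ᵥ
      fun p => (powerWeight k d p : ℂ) * diagVec κ p := by
  have h1 : (Xᴴ * σ).trace = star (X * σ).trace := by
    rw [← Matrix.trace_conjTranspose, Matrix.conjTranspose_mul, hσ.isHermitian.eq,
      Matrix.trace_mul_comm]
  rw [h1, h.trace_mul_eq hσ hk, dotProduct, dotProduct, star_sum]
  refine Finset.sum_congr rfl fun p _ => ?_
  have h2 : star (diagVec κ p) = diagVec κ p := congrFun (star_diagVec κ) p
  rw [star_mul', star_mul', h2, Complex.star_def, Complex.conj_ofReal]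

section

variable {A B κ κ' : Type*} [Fintype A] [DecidableEq A] [Fintype B] [DecidableEq B]
  [Fintype κ] [DecidableEq κ] [Fintype κ'] [DecidableEq κ']
  {ρ : Matrix (A × B) (A × B) ℂ} {k : ℝ} {U : Matrix A κ ℂ} {V : Matrix B κ' ℂ} {d : κ → ℝ}
  {e : κ' → ℝ}

/-- In eigenbases of the marginals the correlation form is a contraction that preserves the
identity. -/
lemma corrData_corrMatrix (hρ : IsState ρ) (hk : k ∈ Set.Icc (0 : ℝ) 1)
    (hU : Diagonalizes U d (marginalA ρ)) (hV : Diagonalizes V e (marginalB ρ)) :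
    CorrData (corrMatrix U V ρ) (powerWeight k d) (powerWeight k e) (diagVec κ) (diagVec κ') := by
  have hA := hρ.marginalA
  have hB := hρ.marginalB
  have oneU : (fun p : κ × κ => (Uᴴ * (1 : Matrix A A ℂ) * U) p.1 p.2) = diagVec κ := by
    rw [Matrix.mul_one, hU.left]; rfl
  have oneV : (fun p : κ' × κ' => (Vᴴ * (1 : Matrix B B ℂ) * V) p.1 p.2) = diagVec κ' := by
    rw [Matrix.mul_one, hV.left]; rfl
  have oneV' : (fun p : κ' × κ' => star ((Vᴴ * (1 : Matrix B B ℂ) * V) p.1 p.2)) = diagVec κ' := by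
    rw [← star_diagVec, ← oneV]; rfl
  refine ⟨fun p => mul_nonneg (Real.rpow_nonneg (hU.nonneg hA.1 _) _)
    (Real.rpow_nonneg (hU.nonneg hA.1 _) _), fun p => mul_nonneg
    (Real.rpow_nonneg (hV.nonneg hB.1 _) _) (Real.rpow_nonneg (hV.nonneg hB.1 _) _), ?_,
    star_diagVec κ, star_diagVec κ', ?_, ?_, ?_, ?_⟩
  · refine (wBound_corrMatrix_iff hU hV _ _ _).2 fun X Y => ?_
    have h := norm_trace_kronecker_sq_le_normSqJ hρ.1 hk X Y
    rw [hU.normSqJ_eq hA.1 hk, hV.normSqJ_eq hB.1 hk] at h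
    rw [one_pow, one_mul]
    exact h
  · have h := hU.trace_mul_eq hA.1 hk 1
    rw [Matrix.one_mul, hA.2, oneU, dotProduct_comm] at h
    exact h.symm
  · have h := hV.trace_mul_eq hB.1 hk 1
    rw [Matrix.one_mul, hB.2, oneV, dotProduct_comm] at h
    exact h.symm
  · refine dotProduct_eq _ _ fun x => ?_
    obtain ⟨X, rfl⟩ := exists_conj_eq hU x
    have h := trace_kronecker_eq_corrMatrix (ρ := ρ) hU.right hV.right X 1
    rw [Matrix.conjTranspose_one, ← trace_mul_marginalA, oneV', hU.trace_mul_eq hA.1 hk] at h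
    rw [dotProduct_comm, ← h, dotProduct_comm]
  · refine dotProduct_eq _ _ fun y => ?_
    obtain ⟨Y, hY⟩ := exists_conj_eq hV (star y)
    have hy : (fun q : κ' × κ' => star ((Vᴴ * Y * V) q.1 q.2)) = y := by
      funext q
      rw [congrFun hY q, Pi.star_apply, star_star]
    have h := trace_kronecker_eq_corrMatrix (ρ := ρ) hU.right hV.right 1 Y
    rw [← trace_mul_marginalB, oneU, hV.trace_conjTranspose_mul_eq hB.1 hk, hy] at h
    rw [← Matrix.dotProduct_mulVec, ← h, dotProduct_comm]

/-- The centred correlation form in eigenbases of the marginals. -/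
lemma corrBound_iff (hρ : IsState ρ) (hk : k ∈ Set.Icc (0 : ℝ) 1)
    (hU : Diagonalizes U d (marginalA ρ)) (hV : Diagonalizes V e (marginalB ρ)) (c : ℝ) :
    CorrBound k ρ c ↔ WBound (centred (corrMatrix U V ρ) (powerWeight k d) (powerWeight k e)
      (diagVec κ) (diagVec κ')) (powerWeight k d) (powerWeight k e) c := by
  have hA := hρ.marginalA
  have hB := hρ.marginalB
  have key : ∀ (X : Matrix A A ℂ) (Y : Matrix B B ℂ),
      ((X ⊗ₖ Yᴴ) * ρ).trace - (X * marginalA ρ).trace * (Yᴴ * marginalB ρ).trace =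
      (fun p : κ × κ => (Uᴴ * X * U) p.1 p.2) ⬝ᵥ centred (corrMatrix U V ρ) (powerWeight k d)
        (powerWeight k e) (diagVec κ) (diagVec κ') *ᵥ
          (fun q : κ' × κ' => star ((Vᴴ * Y * V) q.1 q.2)) := by
    intro X Y
    rw [centred_dotProduct, trace_kronecker_eq_corrMatrix hU.right hV.right,
      hU.trace_mul_eq hA.1 hk, hV.trace_conjTranspose_mul_eq hB.1 hk,
      dotProduct_comm (fun q : κ' × κ' => star ((Vᴴ * Y * V) q.1 q.2))]
  constructor
  · intro h x y
    obtain ⟨X, rfl⟩ := exists_conj_eq hU x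
    obtain ⟨Y, hY⟩ := exists_conj_eq hV (star y)
    have hy : (fun q : κ' × κ' => star ((Vᴴ * Y * V) q.1 q.2)) = y := by
      funext q
      rw [congrFun hY q, Pi.star_apply, star_star]
    have := h X Y
    rwa [key, hU.normSqJ_eq hA.1 hk, hV.normSqJ_eq hB.1 hk, ← wsq_star _ (fun q : κ' × κ' =>
      (Vᴴ * Y * V) q.1 q.2), hy] at this
  · intro h X Y
    rw [key, hU.normSqJ_eq hA.1 hk, hV.normSqJ_eq hB.1 hk, ← wsq_star _ (fun q : κ' × κ' =>
      (Vᴴ * Y * V) q.1 q.2)]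
    exact h _ _

end

lemma WBound.submatrix {I J I' J' : Type*} [Fintype I] [Fintype J] [Fintype I'] [Fintype J']
    {T : Matrix I J ℂ} {w : I → ℝ} {v : J → ℝ} {c : ℝ} (h : WBound T w v c) (f : I' ≃ I)
    (g : J' ≃ J) : WBound (T.submatrix f g) (w ∘ f) (v ∘ g) c := by
  intro x y
  have h1 := h (x ∘ f.symm) (y ∘ g.symm)
  have e1 : wsq w (x ∘ f.symm) = wsq (w ∘ f) x := by
    rw [wsq, ← f.sum_comp]
    simp [wsq]
  have e2 : wsq v (y ∘ g.symm) = wsq (v ∘ g) y := by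
    rw [wsq, ← g.sum_comp]
    simp [wsq]
  have e3 : (x ∘ f.symm) ⬝ᵥ T *ᵥ (y ∘ g.symm) = x ⬝ᵥ T.submatrix f g *ᵥ y := by
    rw [Matrix.submatrix_mulVec_equiv, dotProduct, ← f.sum_comp]
    simp [dotProduct]
  rwa [e1, e2, e3] at h1

lemma wBound_submatrix_iff {I J I' J' : Type*} [Fintype I] [Fintype J] [Fintype I'] [Fintype J']
    {T : Matrix I J ℂ} {w : I → ℝ} {v : J → ℝ} {c : ℝ} (f : I' ≃ I) (g : J' ≃ J) :
    WBound (T.submatrix f g) (w ∘ f) (v ∘ g) c ↔ WBound T w v c := by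
  refine ⟨fun h => ?_, fun h => h.submatrix f g⟩
  simpa [Function.comp_assoc] using h.submatrix f.symm g.symm

section

variable {A B A' B' : Type*}

lemma marginalA_tensorState [Fintype B] [Fintype B'] (ρ : Matrix (A × B) (A × B) ℂ)
    (σ : Matrix (A' × B') (A' × B') ℂ) :
    marginalA (tensorState ρ σ) = marginalA ρ ⊗ₖ marginalA σ := by
  ext ⟨a, a'⟩ ⟨b, b'⟩
  simp [marginalA, tensorState, Fintype.sum_prod_type, Finset.sum_mul_sum]

lemma marginalB_tensorState [Fintype A] [Fintype A'] (ρ : Matrix (A × B) (A × B) ℂ)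
    (σ : Matrix (A' × B') (A' × B') ℂ) :
    marginalB (tensorState ρ σ) = marginalB ρ ⊗ₖ marginalB σ := by
  ext ⟨a, a'⟩ ⟨b, b'⟩
  simp [marginalB, tensorState, Fintype.sum_prod_type, Finset.sum_mul_sum]

lemma IsState.submatrix {ι κ : Type*} [Fintype ι] [Fintype κ] {ρ : Matrix ι ι ℂ} (hρ : IsState ρ)
    (f : κ ≃ ι) : IsState (ρ.submatrix f f) := by
  refine ⟨hρ.1.submatrix f, ?_⟩
  rw [← hρ.2]
  exact f.sum_comp fun i => ρ i i

lemma IsState.kronecker {ι κ : Type*} [Fintype ι] [DecidableEq ι] [Fintype κ] [DecidableEq κ]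
    {ρ : Matrix ι ι ℂ} {σ : Matrix κ κ ℂ} (hρ : IsState ρ) (hσ : IsState σ) :
    IsState (ρ ⊗ₖ σ) :=
  ⟨hρ.1.kronecker hσ.1, by rw [Matrix.trace_kronecker, hρ.2, hσ.2, one_mul]⟩

variable [Fintype A] [DecidableEq A] [Fintype B] [DecidableEq B]
  [Fintype A'] [DecidableEq A'] [Fintype B'] [DecidableEq B']
  {ρ : Matrix (A × B) (A × B) ℂ} {σ : Matrix (A' × B') (A' × B') ℂ}

lemma IsState.tensorState (hρ : IsState ρ) (hσ : IsState σ) : IsState (tensorState ρ σ) :=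
  (hρ.kronecker hσ).submatrix _

lemma Diagonalizes.kronecker {ι ι' κ κ' : Type*} [Fintype ι] [DecidableEq ι] [Fintype ι']
    [DecidableEq ι'] [Fintype κ] [DecidableEq κ] [Fintype κ'] [DecidableEq κ']
    {U : Matrix ι κ ℂ} {d : κ → ℝ} {σ : Matrix ι ι ℂ} {U' : Matrix ι' κ' ℂ} {d' : κ' → ℝ}
    {σ' : Matrix ι' ι' ℂ} (h : Diagonalizes U d σ) (h' : Diagonalizes U' d' σ') :
    Diagonalizes (U ⊗ₖ U') (fun p => d p.1 * d' p.2) (σ ⊗ₖ σ') where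
  left := by
    rw [Matrix.conjTranspose_kronecker, ← Matrix.mul_kronecker_mul, h.left, h'.left,
      Matrix.one_kronecker_one]
  right := by
    rw [Matrix.conjTranspose_kronecker, ← Matrix.mul_kronecker_mul, h.right, h'.right,
      Matrix.one_kronecker_one]
  eq := by
    conv_lhs => rw [h.eq, h'.eq, Matrix.mul_kronecker_mul, Matrix.mul_kronecker_mul,
      Matrix.diagonal_kronecker_diagonal]
    simp [Matrix.conjTranspose_kronecker]

omit [DecidableEq A] [DecidableEq B] [DecidableEq A'] [DecidableEq B'] in
lemma corrMatrix_tensorState {κ κ' ν ν' : Type*} (U : Matrix A κ ℂ) (V : Matrix B ν ℂ)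
    (U' : Matrix A' κ' ℂ) (V' : Matrix B' ν' ℂ) :
    corrMatrix (U ⊗ₖ U') (V ⊗ₖ V') (tensorState ρ σ) =
      (corrMatrix U V ρ ⊗ₖ corrMatrix U' V' σ).submatrix (Equiv.prodProdProdComm κ κ' κ κ')
        (Equiv.prodProdProdComm ν ν' ν ν') := by
  have h : (U ⊗ₖ U') ⊗ₖ (V ⊗ₖ V') = ((U ⊗ₖ V) ⊗ₖ (U' ⊗ₖ V')).submatrix
      (Equiv.prodProdProdComm A A' B B') (Equiv.prodProdProdComm κ κ' ν ν') := by
    ext ⟨⟨a, a'⟩, b, b'⟩ ⟨⟨i, i'⟩, j, j'⟩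
    simp only [Matrix.kronecker_apply, Matrix.submatrix_apply, Equiv.prodProdProdComm_apply]
    ring
  ext p q
  rw [corrMatrix, Matrix.of_apply, h, tensorState, Matrix.conjTranspose_submatrix,
    Matrix.submatrix_mul_equiv, Matrix.submatrix_mul_equiv, Matrix.conjTranspose_kronecker,
    ← Matrix.mul_kronecker_mul, ← Matrix.mul_kronecker_mul]
  rfl

variable {k : ℝ}

lemma corrBound_tensorState_iff {κ κ' ν ν' : Type*} [Fintype κ] [DecidableEq κ] [Fintype κ']
    [DecidableEq κ'] [Fintype ν] [DecidableEq ν] [Fintype ν'] [DecidableEq ν']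
    {U : Matrix A κ ℂ} {V : Matrix B ν ℂ} {U' : Matrix A' κ' ℂ} {V' : Matrix B' ν' ℂ}
    {d : κ → ℝ} {e : ν → ℝ} {d' : κ' → ℝ} {e' : ν' → ℝ}
    (hρ : IsState ρ) (hσ : IsState σ) (hk : k ∈ Set.Icc (0 : ℝ) 1)
    (hU : Diagonalizes U d (marginalA ρ)) (hV : Diagonalizes V e (marginalB ρ))
    (hU' : Diagonalizes U' d' (marginalA σ)) (hV' : Diagonalizes V' e' (marginalB σ)) (c : ℝ) :
    CorrBound k (tensorState ρ σ) c ↔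
      WBound (centred (corrMatrix U V ρ ⊗ₖ corrMatrix U' V' σ)
        (fun p => powerWeight k d p.1 * powerWeight k d' p.2)
        (fun q => powerWeight k e q.1 * powerWeight k e' q.2)
        (fun p => diagVec κ p.1 * diagVec κ' p.2) (fun q => diagVec ν q.1 * diagVec ν' q.2))
        (fun p => powerWeight k d p.1 * powerWeight k d' p.2)
        (fun q => powerWeight k e q.1 * powerWeight k e' q.2) c := by
  have hUU : Diagonalizes (U ⊗ₖ U') (fun p => d p.1 * d' p.2) (marginalA (tensorState ρ σ)) := by
    rw [marginalA_tensorState]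
    exact hU.kronecker hU'
  have hVV : Diagonalizes (V ⊗ₖ V') (fun p => e p.1 * e' p.2) (marginalB (tensorState ρ σ)) := by
    rw [marginalB_tensorState]
    exact hV.kronecker hV'
  rw [corrBound_iff (hρ.tensorState hσ) hk hUU hVV, corrMatrix_tensorState,
    powerWeight_mul k (hU.nonneg hρ.marginalA.1) (hU'.nonneg hσ.marginalA.1),
    powerWeight_mul k (hV.nonneg hρ.marginalB.1) (hV'.nonneg hσ.marginalB.1), diagVec_prod,
    diagVec_prod, ← wBound_submatrix_iff (Equiv.prodProdProdComm κ κ' κ κ')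
      (Equiv.prodProdProdComm ν ν' ν ν')]
  rfl

lemma CorrBound.mono (hρ : ρ.PosSemidef) (hk : k ∈ Set.Icc (0 : ℝ) 1) {c c' : ℝ} (hc : 0 ≤ c)
    (hcc : c ≤ c') (h : CorrBound k ρ c) : CorrBound k ρ c' := by
  intro X Y
  refine (h X Y).trans (mul_le_mul_of_nonneg_right (pow_le_pow_left₀ hc hcc 2) ?_)
  exact mul_nonneg (normSqJ_nonneg (posSemidef_marginalA hρ) hk X)
    (normSqJ_nonneg (posSemidef_marginalB hρ) hk Y)

/-- Tensorization of the maximal correlation. -/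
theorem muLin_tensorState (hρ : IsState ρ) (hσ : IsState σ) (hk : k ∈ Set.Icc (0 : ℝ) 1) :
    muLin (powerFun k) (tensorState ρ σ) =
      max (muLin (powerFun k) ρ) (muLin (powerFun k) σ) := by
  have hU := diagonalizes_eigenvectorUnitary hρ.marginalA.1.isHermitian
  have hV := diagonalizes_eigenvectorUnitary hρ.marginalB.1.isHermitian
  have hU' := diagonalizes_eigenvectorUnitary hσ.marginalA.1.isHermitian
  have hV' := diagonalizes_eigenvectorUnitary hσ.marginalB.1.isHermitian
  have D := corrData_corrMatrix hρ hk hU hV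
  have D' := corrData_corrMatrix hσ hk hU' hV'
  have hτ := hρ.tensorState hσ
  apply le_antisymm
  · set m := (muLin (powerFun k) ρ).toReal with hm
    set m' := (muLin (powerFun k) σ).toReal with hm'
    have h0 : 0 ≤ m := ENNReal.toReal_nonneg
    have h0' : 0 ≤ m' := ENNReal.toReal_nonneg
    rw [← ENNReal.ofReal_toReal (muLin_ne_top hρ hk), ← ENNReal.ofReal_toReal (muLin_ne_top hσ hk),
      ← hm, ← hm', ← ENNReal.ofReal_max, muLin_le_iff hτ hk (h0.trans (le_max_left _ _)),
      corrBound_tensorState_iff hρ hσ hk hU hV hU' hV']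
    refine D.wBound_centred_kronecker D' ?_ ?_
    · exact (corrBound_iff hρ hk hU hV _).1
        ((corrBound_muLin hρ hk).mono hρ.1 hk h0 (le_max_left _ _))
    · exact (corrBound_iff hσ hk hU' hV' _).1
        ((corrBound_muLin hσ hk).mono hσ.1 hk h0' (le_max_right _ _))
  · have h := (corrBound_tensorState_iff hρ hσ hk hU hV hU' hV' _).1 (corrBound_muLin hτ hk)
    rw [← ENNReal.ofReal_toReal (muLin_ne_top hτ hk)]
    refine max_le ?_ ?_
    · rw [muLin_le_iff hρ hk ENNReal.toReal_nonneg, corrBound_iff hρ hk hU hV]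
      exact D'.wBound_left h
    · rw [muLin_le_iff hσ hk ENNReal.toReal_nonneg, corrBound_iff hσ hk hU' hV']
      exact D.wBound_right h

end

/-! ### Tensor powers -/

section

variable {A B : Type*} [Fintype A] [DecidableEq A] [Fintype B] [DecidableEq B]
  {ρ : Matrix (A × B) (A × B) ℂ} {k : ℝ}

lemma Diagonalizes.submatrix {ι ι' κ : Type*} [Fintype ι] [DecidableEq ι] [Fintype ι']
    [DecidableEq ι'] [Fintype κ] [DecidableEq κ] {U : Matrix ι κ ℂ} {d : κ → ℝ}
    {σ : Matrix ι ι ℂ} (h : Diagonalizes U d σ) (f : ι' ≃ ι) :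
    Diagonalizes (U.submatrix f id) d (σ.submatrix f f) where
  left := by
    rw [Matrix.conjTranspose_submatrix, Matrix.submatrix_mul_equiv, h.left, Matrix.submatrix_id_id]
  right := by
    rw [Matrix.conjTranspose_submatrix, ← Matrix.submatrix_mul _ _ _ _ _ Function.bijective_id,
      h.right, Matrix.submatrix_one_equiv]
  eq := by
    conv_lhs => rw [h.eq]
    rw [Matrix.conjTranspose_submatrix, Matrix.submatrix_mul _ _ _ id _ Function.bijective_id,
      Matrix.submatrix_mul _ _ _ id _ Function.bijective_id, Matrix.submatrix_id_id]

/-- The maximal correlation does not depend on the labels of the basis vectors. -/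
lemma muLin_submatrix_le {A₁ B₁ : Type*} [Fintype A₁] [DecidableEq A₁] [Fintype B₁]
    [DecidableEq B₁] (hρ : IsState ρ) (hk : k ∈ Set.Icc (0 : ℝ) 1) (f : A₁ ≃ A) (g : B₁ ≃ B) :
    muLin (powerFun k) (ρ.submatrix (f.prodCongr g) (f.prodCongr g)) ≤ muLin (powerFun k) ρ := by
  have hU := diagonalizes_eigenvectorUnitary hρ.marginalA.1.isHermitian
  have hV := diagonalizes_eigenvectorUnitary hρ.marginalB.1.isHermitian
  have hA : marginalA (ρ.submatrix (f.prodCongr g) (f.prodCongr g)) =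
      (marginalA ρ).submatrix f f := by
    ext a a'
    exact g.sum_comp fun b => ρ (f a, b) (f a', b)
  have hB : marginalB (ρ.submatrix (f.prodCongr g) (f.prodCongr g)) =
      (marginalB ρ).submatrix g g := by
    ext b b'
    exact f.sum_comp fun a => ρ (a, g b) (a, g b')
  have hU' := hU.submatrix f
  have hV' := hV.submatrix g
  rw [← hA] at hU'
  rw [← hB] at hV'
  rw [← ENNReal.ofReal_toReal (muLin_ne_top hρ hk),
    muLin_le_iff (hρ.submatrix _) hk ENNReal.toReal_nonneg,
    corrBound_iff (hρ.submatrix _) hk hU' hV']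
  have h := (corrBound_iff hρ hk hU hV _).1 (corrBound_muLin hρ hk)
  generalize (hρ.marginalA.1.isHermitian.eigenvectorUnitary : Matrix A A ℂ) = U at h ⊢
  generalize (hρ.marginalB.1.isHermitian.eigenvectorUnitary : Matrix B B ℂ) = V at h ⊢
  have hcorr : corrMatrix (U.submatrix f id) (V.submatrix g id)
      (ρ.submatrix (f.prodCongr g) (f.prodCongr g)) = corrMatrix U V ρ := by
    have hW : (U.submatrix f id) ⊗ₖ (V.submatrix g id) =
        (U ⊗ₖ V).submatrix (f.prodCongr g) id := rfl
    ext p q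
    rw [corrMatrix, Matrix.of_apply, hW, Matrix.conjTranspose_submatrix,
      Matrix.submatrix_mul_equiv, Matrix.submatrix_mul_equiv, Matrix.submatrix_id_id]
    rfl
  rw [hcorr]
  exact h

/-- A bipartite state on one-dimensional spaces has no correlation. -/
lemma muLin_eq_zero_of_unique [Unique A] [Unique B] (hρ : IsState ρ)
    (hk : k ∈ Set.Icc (0 : ℝ) 1) : muLin (powerFun k) ρ = 0 := by
  have hX : ∀ X : Matrix A A ℂ, X - (X * marginalA ρ).trace • 1 = 0 := by
    intro X
    have h := hρ.marginalA.2
    ext i j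
    obtain rfl := Subsingleton.elim i default
    obtain rfl := Subsingleton.elim j default
    simp only [Matrix.trace, Matrix.diag, Finset.univ_unique, Finset.sum_singleton] at h
    simp [Matrix.trace, Matrix.mul_apply, h]
  rw [← nonpos_iff_eq_zero, ← ENNReal.ofReal_zero, muLin_le_iff hρ hk le_rfl]
  intro X Y
  rw [← trace_sub_smul_one_kronecker hρ, hX]
  simp

omit [Fintype A] [DecidableEq A] [Fintype B] [DecidableEq B] in
lemma tensorPower_succ (n : ℕ) (ρ : Matrix (A × B) (A × B) ℂ) :
    tensorPower (n + 1) ρ = (tensorState ρ (tensorPower n ρ)).submatrix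
      ((Fin.consEquiv fun _ : Fin (n + 1) => A).symm.prodCongr
        (Fin.consEquiv fun _ : Fin (n + 1) => B).symm)
      ((Fin.consEquiv fun _ : Fin (n + 1) => A).symm.prodCongr
        (Fin.consEquiv fun _ : Fin (n + 1) => B).symm) := by
  ext x y
  simp only [tensorPower, Matrix.of_apply, Fin.prod_univ_succ]
  rfl

lemma isState_tensorPower (hρ : IsState ρ) (n : ℕ) : IsState (tensorPower n ρ) := by
  induction n with
  | zero =>
    have : tensorPower 0 ρ = 1 := by
      ext x y
      rw [Subsingleton.elim x y]
      simp [tensorPower]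
    rw [this]
    exact ⟨Matrix.PosSemidef.one, by simp⟩
  | succ n ih =>
    rw [tensorPower_succ]
    exact (hρ.tensorState ih).submatrix _

lemma muLin_tensorPower_le (hρ : IsState ρ) (hk : k ∈ Set.Icc (0 : ℝ) 1) (n : ℕ) :
    muLin (powerFun k) (tensorPower n ρ) ≤ muLin (powerFun k) ρ := by
  induction n with
  | zero =>
    rw [muLin_eq_zero_of_unique (isState_tensorPower hρ 0) hk]
    exact zero_le
  | succ n ih =>
    have hn := isState_tensorPower hρ n
    rw [tensorPower_succ]
    refine (muLin_submatrix_le (hρ.tensorState hn) hk _ _).trans ?_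
    rw [muLin_tensorState hρ hn hk]
    exact max_le le_rfl ih

end

end MaxCorr

end

theorem mainTheorem3 {A B A' B' : Type*}
    [Fintype A] [DecidableEq A] [Fintype B] [DecidableEq B]
    [Fintype A'] [DecidableEq A'] [Fintype B'] [DecidableEq B']
    (ρ : Matrix (A × B) (A × B) ℂ) (σ : Matrix (A' × B') (A' × B') ℂ)
    (hρ : MaxCorr.IsState ρ) (hσ : MaxCorr.IsState σ) :
    ((∃ n : ℕ, MaxCorr.LocallyConvertible n ρ σ) →
      ∀ k ∈ Set.Icc (0 : ℝ) 1,
        MaxCorr.muLin (MaxCorr.powerFun k) σ ≤ MaxCorr.muLin (MaxCorr.powerFun k) ρ) ∧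
    (∀ k ∈ Set.Icc (0 : ℝ) 1,
      MaxCorr.muLin (MaxCorr.powerFun k) (MaxCorr.tensorState ρ σ) =
        max (MaxCorr.muLin (MaxCorr.powerFun k) ρ) (MaxCorr.muLin (MaxCorr.powerFun k) σ)) := by
  refine ⟨?_, fun k hk => MaxCorr.muLin_tensorState hρ hσ hk⟩
  rintro ⟨n, ℰ, ℱ, hE, hE', hF, hF', rfl⟩ k hk
  exact (MaxCorr.muLin_tensorMap_le hE hE' hF hF' (MaxCorr.isState_tensorPower hρ n) hσ hk).trans
    (MaxCorr.muLin_tensorPower_le hρ hk n)
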